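/- \textbf{Model.} Three parties, Alice (1), Bob (2) and Charlie (3), are pairwise connected by private links and communicate in synchronous rounds. Alice has input $X\in\mathcal X$, Bob has input $Y\in\mathcal Y$, and Charlie produces an output $Z\in\mathcal Z$ (finite alphabets). In each round every party sends a (possibly empty) bit string on each of its two links, drawn from a distribution that depends only on that party's input and on the messages exchanged so far on its two links; the choices of different parties in a round are independent given these data. A protocol is \emph{well-formed} if (a) on each link and in each direction the message sent in a round is a codeword of a prefix-free code that is determined by the messages exchanged on that link in previous rounds, and (b) with probability 1 the protocol terminates, i.e. reaches a state from which on all messages are empty. The transcript $M_{ij}$ of the link $ij$ is the pair of strings obtained by concatenating the bits sent in each direction until termination. Charlie's output is a probabilistic function of $(M_{23},M_{31})$. The views are $V_1=(X,M_{12},M_{31})$, $V_2=(Y,M_{12},M_{23})$, $V_3=(Z,M_{23},M_{31})$. A protocol (which may depend on the input distribution $p_{XY}$) is a \emph{secure protocol} for $(p_{XY},p_{Z|XY})$ if Charlie's output has distribution $p_{Z|X=x,Y=y}$ whenever the inputs are $x,y$ with $p_{XY}(x,y)>0$, and if, for $(X,Y)\sim p_{XY}$, the Markov chains $(M_{12},M_{31})-X-(Y,Z)$,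 $(M_{12},M_{23})-Y-(X,Z)$ and $(M_{23},M_{31})-Z-(X,Y)$ hold. The randomness of a protocol is $H(V_1,V_2,V_3\mid X,Y)$, and $\rho(p_{XY},p_{Z|XY})$ is the infimum of this quantity over all secure protocols. Entropies are in bits with values in $[0,\infty]$, and $\log=\log_2$. \textbf{Theorem.} Let $n\ge 0$, let $\mathrm{SUM}$ be the componentwise arithmetic sum $\{0,1\}^n\times\{0,1\}^n\to\{0,1,2\}^n$, $(x,y)\mapsto x+y$, and let $p_{XY}$ be any distribution with full support on $\{0,1\}^n\times\{0,1\}^n$. \begin{enumerate} \item Every secure protocol for $(p_{XY},\mathrm{SUM})$ satisfies $H(M_{31})\ge n\log 3$, $H(M_{23})\ge n\log 3$ and $H(M_{12})\ge 1.5\,n$. \item $\rho(p_{XY},\mathrm{SUM})\ge n\log 3$. \item The following mod-3 protocol is a (well-formed) secure protocol for $(p_{XY},\mathrm{SUM})$ and is randomness-optimal: its randomness equals $\rho(p_{XY},\mathrm{SUM})=n\log 3$. Charlie sends a uniform $K\in\{0,1,2\}^n$ to Alice; Alice then sends $K+X \bmod 3$ to Bob; Bob then sends $K+X+Y \bmod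 3$ to Charlie, who outputs $(K+X+Y)-K \bmod 3$. (Additions are componentwise, and ternary symbols are encoded by the prefix-free code $0\mapsto 0$, $1\mapsto 10$, $2\mapsto 11$.) \end{enumerate} -/

import Mathlib

open scoped ENNReal

noncomputable section

namespace ThreeParty

/-! ### Discrete information measures (logarithms to base 2, values in `[0, ∞]`) -/

section Information

variable {Ω α β γ : Type*}

/-- Shannon entropy `H(A)` in bits of the discrete random variable `A` under the law `μ`. -/
def entropy (μ : PMF Ω) (A : Ω → α) : ℝ≥0∞ :=
  ∑' a, ENNReal.ofReal (-((μ.map A a).toReal * Real.logb 2 (μ.map A a).toReal))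

/-- Conditional Shannon entropy `H(A | B) = - ∑ p(a,b) log (p(a,b) / p(b))` in bits. Each summand is
nonnegative since `p(a,b) ≤ p(b)`. -/
def condEntropy (μ : PMF Ω) (A : Ω → α) (B : Ω → β) : ℝ≥0∞ :=
  ∑' b, ∑' a, ENNReal.ofReal
    (-((μ.map (fun ω => (A ω, B ω)) (a, b)).toReal *
      Real.logb 2 ((μ.map (fun ω => (A ω, B ω)) (a, b)).toReal / (μ.map B b).toReal)))

/-- The Markov chain `A - B - C`: `A` and `C` are conditionally independent given `B`, that is,
`p(a,b,c) p(b) = p(a,b) p(b,c)`. -/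
def MarkovChain (μ : PMF Ω) (A : Ω → α) (B : Ω → β) (C : Ω → γ) : Prop :=
  ∀ a b c, μ.map (fun ω => (A ω, B ω, C ω)) (a, b, c) * μ.map B b =
    μ.map (fun ω => (A ω, B ω)) (a, b) * μ.map (fun ω => (B ω, C ω)) (b, c)

end Information

/-! ### Protocols -/

/-- Messages are bit strings, possibly empty. -/
abbrev Msg : Type := List Bool

/-- The six messages sent in one (synchronous) round; `mij` is sent by party `i` to party `j`. -/
structure Round : Type where
  m12 : Msg
  m21 : Msg
  m23 : Msg
  m32 : Msg
  m31 : Msg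
  m13 : Msg

/-- A round in which nobody sends anything. -/
def emptyRound : Round := ⟨[], [], [], [], [], []⟩

/-- The messages sent on all links so far, round by round in chronological order. -/
abbrev History : Type := List Round

/-- The messages sent on one link `ij` so far, round by round: the first component is the message
from `i` to `j`, the second one the message from `j` to `i`. -/
abbrev LinkHistory : Type := List (Msg × Msg)

/-- Messages on the link between Alice (party 1) and Bob (party 2). -/
def link12 (h : History) : LinkHistory := h.map fun r => (r.m12, r.m21)

/-- Messages on the link between Bob (party 2) and Charlie (party 3). -/
def link23 (h : History) : LinkHistory := h.map fun r => (r.m23, r.m32)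

/-- Messages on the link between Charlie (party 3) and Alice (party 1). -/
def link31 (h : History) : LinkHistory := h.map fun r => (r.m31, r.m13)

/-- The transcript of a link: the concatenation of all bits sent in each of the two directions. -/
abbrev Transcript : Type := Msg × Msg

/-- Concatenate the messages of a link in each direction. -/
def LinkHistory.transcript (l : LinkHistory) : Transcript :=
  ((l.map Prod.fst).flatten, (l.map Prod.snd).flatten)

/-- The transcripts on the three links. -/
structure Transcripts : Type where
  M12 : Transcript
  M23 : Transcript
  M31 : Transcript

/-- The transcripts on the three links at a given point of the execution. -/
def transcriptsOf (h : History) : Transcripts :=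
  ⟨(link12 h).transcript, (link23 h).transcript, (link31 h).transcript⟩

/-- Probabilistic next message functions of the three parties and output function of Charlie.
Alice and Bob have inputs in `X` and `Y`; Charlie has no input and produces an output in `Z`. The
messages of a party depend on its input and on the messages on its two links so far. -/
structure NextMessage (X Y Z : Type*) where
  /-- Alice: input, messages on link 12, messages on link 31; sends (to Bob, to Charlie). -/
  alice : X → LinkHistory → LinkHistory → PMF (Msg × Msg)
  /-- Bob: input, messages on link 12, messages on link 23; sends (to Alice, to Charlie). -/
  bob : Y → LinkHistory → LinkHistory → PMF (Msg × Msg)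
  /-- Charlie: messages on link 23, messages on link 31; sends (to Alice, to Bob). -/
  charlie : LinkHistory → LinkHistory → PMF (Msg × Msg)
  /-- The output of Charlie, from the final transcripts on the links 23 and 31. -/
  out : Transcript → Transcript → PMF Z

/-- A code is prefix-free if no codeword is a proper prefix of another one. -/
def PrefixFree (C : Set Msg) : Prop := ∀ u ∈ C, ∀ v ∈ C, u <+: v → u = v

namespace NextMessage

variable {X Y Z : Type*} (P : NextMessage X Y Z)

/-- The distribution of the messages of the next round: the three parties act independently. -/
def step (x : X) (y : Y) (h : History) : PMF Round :=
  (P.alice x (link12 h) (link31 h)).bind fun a =>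
    (P.bob y (link12 h) (link23 h)).bind fun b =>
      (P.charlie (link23 h) (link31 h)).map fun c =>
        { m12 := a.1, m13 := a.2, m21 := b.1, m23 := b.2, m31 := c.1, m32 := c.2 }

/-- The distribution of the messages of the first `t` rounds on inputs `x`, `y`. -/
def run (x : X) (y : Y) : ℕ → PMF History
  | 0 => PMF.pure []
  | t + 1 => (run x y t).bind fun h => (P.step x y h).map fun r => h ++ [r]

/-- The protocol has terminated: from now on all parties send empty strings only. -/
def Terminated (x : X) (y : Y) (h : History) : Prop :=
  ∀ k : ℕ, P.step x y (h ++ List.replicate k emptyRound) = PMF.pure emptyRound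

/-- The probability that the protocol has terminated within the first `t` rounds and that the
transcripts are `m`. -/
def terminatedMass (x : X) (y : Y) (t : ℕ) (m : Transcripts) : ℝ≥0∞ :=
  (P.run x y t).toOuterMeasure {h | P.Terminated x y h ∧ transcriptsOf h = m}

/-- The probability that the protocol has terminated within the first `t` rounds. -/
def terminatedProb (x : X) (y : Y) (t : ℕ) : ℝ≥0∞ :=
  (P.run x y t).toOuterMeasure {h | P.Terminated x y h}

/-- On every link and in each direction, the message sent in a round is a codeword of a
prefix-free code, and this code is determined by the messages exchanged on that link in the
previous rounds. Only messages that occur with positive probability matter. -/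
def PrefixFreeMessages : Prop :=
  ∃ c12 c21 c23 c32 c31 c13 : LinkHistory → Set Msg,
    (∀ l, PrefixFree (c12 l) ∧ PrefixFree (c21 l) ∧ PrefixFree (c23 l) ∧ PrefixFree (c32 l) ∧
      PrefixFree (c31 l) ∧ PrefixFree (c13 l)) ∧
    ∀ x y t, ∀ h ∈ (P.run x y t).support, ∀ r ∈ (P.step x y h).support,
      r.m12 ∈ c12 (link12 h) ∧ r.m21 ∈ c21 (link12 h) ∧
      r.m23 ∈ c23 (link23 h) ∧ r.m32 ∈ c32 (link23 h) ∧
      r.m31 ∈ c31 (link31 h) ∧ r.m13 ∈ c13 (link31 h)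

variable {P}

theorem Terminated.append {x : X} {y : Y} {h : History} (hh : P.Terminated x y h) :
    P.Terminated x y (h ++ [emptyRound]) := by
  intro k
  have := hh (k + 1)
  rwa [List.replicate_succ, ← List.singleton_append, ← List.append_assoc] at this

theorem transcriptsOf_append_emptyRound (h : History) :
    transcriptsOf (h ++ [emptyRound]) = transcriptsOf h := by
  simp [transcriptsOf, link12, link23, link31, LinkHistory.transcript, emptyRound]

theorem terminatedMass_mono (x : X) (y : Y) (m : Transcripts) :
    Monotone fun t => P.terminatedMass x y t m := by
  refine monotone_nat_of_le_succ fun t => ?_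
  simp only [terminatedMass, run]
  rw [PMF.toOuterMeasure_bind_apply, PMF.toOuterMeasure_apply]
  refine ENNReal.tsum_le_tsum fun h => ?_
  by_cases hh : P.Terminated x y h ∧ transcriptsOf h = m
  · have h0 : P.step x y h = PMF.pure emptyRound := by simpa using hh.1 0
    have h1 : h ++ [emptyRound] ∈ {h | P.Terminated x y h ∧ transcriptsOf h = m} :=
      ⟨hh.1.append, by rw [transcriptsOf_append_emptyRound]; exact hh.2⟩
    rw [h0, PMF.pure_map, PMF.toOuterMeasure_pure_apply, if_pos h1, mul_one]
    exact Set.indicator_le_self _ _ _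
  · rw [Set.indicator_of_notMem (by exact hh)]
    exact zero_le

theorem tsum_terminatedMass (x : X) (y : Y) (t : ℕ) :
    ∑' m, P.terminatedMass x y t m = P.terminatedProb x y t := by
  simp only [terminatedMass, terminatedProb, PMF.toOuterMeasure_apply]
  rw [ENNReal.tsum_comm]
  refine tsum_congr fun h => ?_
  rw [tsum_eq_single (transcriptsOf h)]
  · by_cases hh : P.Terminated x y h <;> simp [Set.indicator, hh]
  · intro m hm
    refine Set.indicator_of_notMem ?_ _
    exact fun hh => hm hh.2.symm

theorem tsum_iSup_terminatedMass (x : X) (y : Y) :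
    ∑' m, ⨆ t, P.terminatedMass x y t m = ⨆ t, P.terminatedProb x y t := by
  let _ : MeasurableSpace Transcripts := ⊤
  simp_rw [← tsum_terminatedMass]
  simp_rw [← MeasureTheory.lintegral_count]
  exact MeasureTheory.lintegral_iSup (fun _ => measurable_from_top)
    fun s t hst m => terminatedMass_mono x y m hst

end NextMessage

/-- A well-formed three-party protocol: messages are codewords of prefix-free codes, and the
protocol terminates with probability 1. -/
structure Protocol (X Y Z : Type*) extends NextMessage X Y Z where
  prefixFree : toNextMessage.PrefixFreeMessages
  terminates : ∀ x y, ⨆ t, toNextMessage.terminatedProb x y t = 1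

/-- The outcome of an execution: the inputs, the final transcripts and the output. -/
structure Outcome (X Y Z : Type*) where
  x : X
  y : Y
  T : Transcripts
  z : Z

namespace Protocol

variable {X Y Z : Type*} (P : Protocol X Y Z)

/-- The distribution of the final transcripts on inputs `x`, `y`. -/
def transcripts (x : X) (y : Y) : PMF Transcripts :=
  ⟨fun m => ⨆ t, P.terminatedMass x y t m, by
    have h := (NextMessage.tsum_iSup_terminatedMass (P := P.toNextMessage) x y).trans
      (P.terminates x y)
    exact h ▸ ENNReal.summable.hasSum⟩

/-- The joint distribution of inputs, final transcripts and output when the inputs of Alice and Bob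
are drawn from `p`. -/
def law (p : PMF (X × Y)) : PMF (Outcome X Y Z) :=
  p.bind fun xy => (P.transcripts xy.1 xy.2).bind fun T =>
    (P.out T.M23 T.M31).map fun z => ⟨xy.1, xy.2, T, z⟩

/-- Perfectly secure computation of the randomized function `F` (where `F x y` is the distribution of
the output on inputs `x`, `y`) under the input distribution `p`, against one passively corrupt
party. -/
structure IsSecure (p : PMF (X × Y)) (F : X → Y → PMF Z) : Prop where
  /-- On every pair of inputs that can occur, the output of Charlie is distributed as `F x y`. -/
  correct : ∀ x y, p (x, y) ≠ 0 →
    ((P.transcripts x y).bind fun T => P.out T.M23 T.M31) = F x y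
  /-- `(M12, M31) - X - (Y, Z)`. -/
  privacy_alice : MarkovChain (P.law p) (fun o => (o.T.M12, o.T.M31)) (fun o => o.x)
    (fun o => (o.y, o.z))
  /-- `(M12, M23) - Y - (X, Z)`. -/
  privacy_bob : MarkovChain (P.law p) (fun o => (o.T.M12, o.T.M23)) (fun o => o.y)
    (fun o => (o.x, o.z))
  /-- `(M23, M31) - Z - (X, Y)`. -/
  privacy_charlie : MarkovChain (P.law p) (fun o => (o.T.M23, o.T.M31)) (fun o => o.z)
    (fun o => (o.x, o.y))

/-- The entropy of the final transcript on the link between Alice and Bob. -/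
def H12 (p : PMF (X × Y)) : ℝ≥0∞ := entropy (P.law p) fun o => o.T.M12

/-- The entropy of the final transcript on the link between Bob and Charlie. -/
def H23 (p : PMF (X × Y)) : ℝ≥0∞ := entropy (P.law p) fun o => o.T.M23

/-- The entropy of the final transcript on the link between Charlie and Alice. -/
def H31 (p : PMF (X × Y)) : ℝ≥0∞ := entropy (P.law p) fun o => o.T.M31

/-- The view of Alice: her input and the transcripts on her links. -/
def viewAlice (o : Outcome X Y Z) : X × Transcript × Transcript := (o.x, o.T.M12, o.T.M31)

/-- The view of Bob: his input and the transcripts on his links. -/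
def viewBob (o : Outcome X Y Z) : Y × Transcript × Transcript := (o.y, o.T.M12, o.T.M23)

/-- The view of Charlie: his output and the transcripts on his links. -/
def viewCharlie (o : Outcome X Y Z) : Z × Transcript × Transcript := (o.z, o.T.M23, o.T.M31)

/-- The randomness `H(V1, V2, V3 | X, Y)` used by a protocol, where `Vi` is the view of party `i`. -/
def randomness (p : PMF (X × Y)) : ℝ≥0∞ :=
  condEntropy (P.law p) (fun o => (viewAlice o, viewBob o, viewCharlie o)) fun o => (o.x, o.y)

end Protocol

/-- The randomness required to securely compute `F` for the input distribution `p`: the infimum of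
the randomness over all secure protocols. -/
def requiredRandomness {X Y Z : Type*} (p : PMF (X × Y)) (F : X → Y → PMF Z) : ℝ≥0∞ :=
  ⨅ (P : Protocol X Y Z) (_ : P.IsSecure p F), P.randomness p

/-! ### Componentwise arithmetic sum of bits -/

/-- The function `SUM` on `{0,1}^n × {0,1}^n`: the componentwise arithmetic sum in `{0,1,2}^n`. -/
def sumFun (n : ℕ) (x y : Fin n → Fin 2) : Fin n → Fin 3 :=
  fun i => ⟨(x i : ℕ) + (y i : ℕ), by omega⟩

/-- `SUM` as a (deterministic) functionality. -/
def sumFunctionality (n : ℕ) (x y : Fin n → Fin 2) : PMF (Fin n → Fin 3) :=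
  PMF.pure (sumFun n x y)

/-- A prefix-free binary encoding of a ternary symbol. -/
def encodeTrit (a : Fin 3) : Msg := ![[false], [true, false], [true, true]] a

/-- The encoding of a vector of ternary symbols, symbol by symbol. -/
def encode {n : ℕ} (v : Fin n → Fin 3) : Msg := (List.ofFn fun i => encodeTrit (v i)).flatten

/-- Decoding: the inverse of `encode`. -/
def decode (n : ℕ) : Msg → (Fin n → Fin 3) := Function.invFun encode

/-- The inclusion of `{0,1}^n` into `{0,1,2}^n`. -/
def toTrits {n : ℕ} (x : Fin n → Fin 2) : Fin n → Fin 3 := fun i => (x i).castSucc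

/-- The mod-3 protocol for `SUM`. In the first round, Charlie sends a uniform `K` in `{0,1,2}^n` to
Alice. In the second round, Alice sends `K + x` to Bob. In the third round, Bob adds `y` to what he
received and sends the result to Charlie, who outputs this result minus `K`. Addition in `Fin 3` is
modulo 3. -/
def mod3Protocol (n : ℕ) : NextMessage (Fin n → Fin 2) (Fin n → Fin 2) (Fin n → Fin 3) where
  charlie l23 _ :=
    if l23.length = 0 then
      (PMF.uniformOfFintype (Fin n → Fin 3)).map fun K => (encode K, [])
    else PMF.pure ([], [])
  alice x _ l31 :=
    if l31.length = 1 then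
      PMF.pure (encode (decode n (LinkHistory.transcript l31).1 + toTrits x), [])
    else PMF.pure ([], [])
  bob y l12 _ :=
    if l12.length = 2 then
      PMF.pure ([], encode (decode n (LinkHistory.transcript l12).1 + toTrits y))
    else PMF.pure ([], [])
  out M23 M31 := PMF.pure (decode n M23.1 - decode n M31.1)

end ThreeParty

end

/-! As p has full support, privacy says that the law of a party's two transcripts depends only on
what the party may know: x for Alice, y for Bob, z for Charlie. Moving between input pairs along
these invariances shows that the law of each single transcript does not depend on the inputs at all.
By correctness, the laws of (M23, M31) for the 3^n values of z have disjoint supports; as they share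
their marginals, no value of M31 or M23 has mass above 3^-n (`card_mul_map_snd_le_one`). This yields
both n log 3 bounds, and also the randomness bound, since the views contain M31.

The bound on M12 rests on a correlation inequality for independent inputs
(`exists_transcripts_weights`): P(M12) P(M23) P(M31) P(M) is at most a product of three
subprobability weights, one for each pair of links. The probability of a history is a product of one
factor per party, a function of that party's view. Each link marginal splits into its two
directions, and giving each direction to the receiving party turns that party's factor into a causal
subprobability on its views. This is done for t rounds, where prefix-free codes make transcripts
decodable, and then passed to the limit.

The inequality is used for uniform inputs. Exchanging inputs between executions shows that Alice's
transcripts determine x and Bob's determine y (`alice_input_eq`, `bob_input_eq`). With log t ≤ t - 1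
for four ratios of mean at most 1 (`log_le_of_mul_le`), H(M12) is at least the entropy of X + Y for
uniform X, Y, which is 1.5 n. The law of M12 does not depend on the inputs, so the bound holds for
p.

In the mod-3 protocol, K is a one-time pad: each view is simulated from what the party may know, and
given the inputs everything is a function of K. -/

open scoped ENNReal

noncomputable section

namespace ThreeParty

open Filter Topology

/-! ### Causal weights on lists and their directional splitting -/

section CausalWeight

variable {σ τ : Type*}

/-- The product of the weights `k prefix next` over all elements of a list. -/
def causalWeight (k : List σ → σ → ℝ≥0∞) (l : List σ) : ℝ≥0∞ :=
  List.reverseRecOn (motive := fun _ => ℝ≥0∞) l 1 fun l s w => w * k l s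

@[simp]
theorem causalWeight_nil (k : List σ → σ → ℝ≥0∞) : causalWeight k [] = 1 := by
  simp [causalWeight]

@[simp]
theorem causalWeight_concat (k : List σ → σ → ℝ≥0∞) (l : List σ) (s : σ) :
    causalWeight k (l ++ [s]) = causalWeight k l * k l s := by
  simp [causalWeight]

theorem causalWeight_mul (k k' : List σ → σ → ℝ≥0∞) (l : List σ) :
    causalWeight (fun l s => k l s * k' l s) l = causalWeight k l * causalWeight k' l := by
  induction l using List.reverseRecOn with
  | nil => simp
  | append_singleton l s ih => simp only [causalWeight_concat, ih]; ring

theorem causalWeight_map (k : List τ → τ → ℝ≥0∞) (f : σ → τ) (l : List σ) :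
    causalWeight (fun l s => k (l.map f) (f s)) l = causalWeight k (l.map f) := by
  induction l using List.reverseRecOn with
  | nil => simp
  | append_singleton l s ih =>
    rw [List.map_append, List.map_singleton, causalWeight_concat, causalWeight_concat, ih]

theorem tsum_list_concat (F : List σ → ℝ≥0∞) (h0 : F [] = 0) :
    ∑' l, F l = ∑' l, ∑' s, F (l ++ [s]) := by
  rw [← ENNReal.tsum_prod]
  symm
  refine Function.Injective.tsum_eq (g := fun q : List σ × σ => q.1 ++ [q.2]) ?_ ?_
  · rintro ⟨l, s⟩ ⟨l', s'⟩ h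
    simpa using List.append_inj' h rfl
  · intro l hl
    induction l using List.reverseRecOn with
    | nil => exact absurd h0 hl
    | append_singleton l s _ => exact ⟨(l, s), rfl⟩

/-- Lists of length t + 1 are the one-letter extensions of lists of length t, so the total weight
cannot grow with t. -/
theorem tsum_length_le (W : List σ → ℝ≥0∞) (hW : ∀ l, ∑' s, W (l ++ [s]) ≤ W l) (t : ℕ) :
    ∑' l, (if l.length = t then W l else 0) ≤ W [] := by
  induction t with
  | zero =>
    rw [tsum_eq_single []]
    · simp
    · intro l hl
      simp [hl]
  | succ t ih =>
    rw [tsum_list_concat _ (by simp)]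
    refine le_trans (ENNReal.tsum_le_tsum fun l => ?_) ih
    by_cases h : l.length = t <;> simp [h, hW]

theorem le_nil_of_tsum_concat_le (W : List σ → ℝ≥0∞) (hW : ∀ l, ∑' s, W (l ++ [s]) ≤ W l)
    (l : List σ) : W l ≤ W [] := by
  induction l using List.reverseRecOn with
  | nil => rfl
  | append_singleton l s ih => exact ((ENNReal.le_tsum s).trans (hW l)).trans ih

open scoped Classical in
/-- The image of a weight on lists under a letterwise map. -/
def pushWeight (R : List σ → ℝ≥0∞) (f : σ → τ) (l : List τ) : ℝ≥0∞ :=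
  ∑' h, if h.map f = l then R h else 0

theorem pushWeight_nil (R : List σ → ℝ≥0∞) (f : σ → τ) : pushWeight R f [] = R [] := by
  rw [pushWeight, tsum_eq_single []]
  · simp
  · intro l hl
    simp [hl]

/-- The preimages of `l ++ [s]` are the extensions `h ++ [r]` of preimages `h` of `l` with `f r =
s`; summing over `s` removes the constraint on `r`. -/
theorem tsum_pushWeight_concat_le (R : List σ → ℝ≥0∞) (hR : ∀ h, ∑' r, R (h ++ [r]) ≤ R h)
    (f : σ → τ) (l : List τ) : ∑' s, pushWeight R f (l ++ [s]) ≤ pushWeight R f l := by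
  classical
  unfold pushWeight
  rw [ENNReal.tsum_comm, tsum_list_concat]
  · refine ENNReal.tsum_le_tsum fun h => ?_
    by_cases hl : h.map f = l
    · rw [if_pos hl]
      refine le_trans (ENNReal.tsum_le_tsum fun r => ?_) (hR h)
      rw [tsum_eq_single (f r)]
      · split_ifs <;> simp
      · intro s hs
        rw [if_neg]
        intro h'
        rw [List.map_append, List.map_singleton] at h'
        exact hs (by simpa using (List.append_inj_right' h' rfl).symm)
    · rw [if_neg hl]
      simp only [nonpos_iff_eq_zero, ENNReal.tsum_eq_zero]
      intro r s
      rw [if_neg]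
      intro h'
      rw [List.map_append, List.map_singleton] at h'
      exact hl (List.append_inj_left' h' rfl)
  · simp

/-- A causally consistent weight on lists of pairs factors into conditional weights of the first
and of the second components. -/
theorem exists_directional_weights (P : List (σ × τ) → ℝ≥0∞) (h0 : P [] ≤ 1)
    (hP : ∀ l, ∑' s, P (l ++ [s]) ≤ P l) :
    ∃ (k₁ : List (σ × τ) → σ → ℝ≥0∞) (k₂ : List (σ × τ) → σ → τ → ℝ≥0∞),
      (∀ l, ∑' a, k₁ l a ≤ 1) ∧ (∀ l a, ∑' b, k₂ l a b ≤ 1) ∧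
      ∀ l, P l ≤ causalWeight (fun l s => k₁ l s.1) l * causalWeight (fun l s => k₂ l s.1 s.2) l := by
  have hle : ∀ l, P l ≤ 1 := fun l => (le_nil_of_tsum_concat_le P hP l).trans h0
  have hle' : ∀ l a, ∑' b, P (l ++ [(a, b)]) ≤ P l := fun l a => by
    refine le_trans ?_ (hP l)
    rw [ENNReal.tsum_prod']
    exact ENNReal.le_tsum (f := fun a => ∑' b, P (l ++ [(a, b)])) a
  -- Conditional weights of the first component given the past, and of the second given the past and
  -- the current first component. The product telescopes; division by zero only occurs where `P`
  -- vanishes.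
  refine ⟨fun l a => (∑' b, P (l ++ [(a, b)])) / P l,
    fun l a b => P (l ++ [(a, b)]) / ∑' b', P (l ++ [(a, b')]), fun l => ?_, fun l a => ?_,
    fun l => ?_⟩
  · simp only [div_eq_mul_inv]
    rw [ENNReal.tsum_mul_right, ← ENNReal.tsum_prod (f := fun a b => P (l ++ [(a, b)])),
      ← div_eq_mul_inv]
    exact ENNReal.div_le_of_le_mul (by simpa using hP l)
  · simp only [div_eq_mul_inv]
    rw [ENNReal.tsum_mul_right]
    exact ENNReal.mul_inv_le_one _
  · induction l using List.reverseRecOn with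
    | nil => simpa using h0
    | append_singleton l s ih =>
      obtain ⟨a, b⟩ := s
      rw [causalWeight_concat, causalWeight_concat, mul_mul_mul_comm]
      refine le_trans ?_ (mul_le_mul_left ih _)
      have hfin : ∑' b, P (l ++ [(a, b)]) ≠ ∞ := ne_top_of_le_ne_top ENNReal.one_ne_top
        ((hle' l a).trans (hle l))
      by_cases hz : P l = 0
      · have : P (l ++ [(a, b)]) ≤ P l :=
          (ENNReal.le_tsum (f := fun b => P (l ++ [(a, b)])) b).trans (hle' l a)
        simp_all
      by_cases hz' : ∑' b, P (l ++ [(a, b)]) = 0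
      · have : P (l ++ [(a, b)]) = 0 := ENNReal.tsum_eq_zero.1 hz' b
        simp [this]
      rw [← mul_assoc, ENNReal.mul_div_cancel hz (ne_top_of_le_ne_top ENNReal.one_ne_top (hle l)),
        ENNReal.mul_div_cancel hz' hfin]

variable {O₁ T₁ O₂ T₂ : Type*}

/-- An incoming message may depend on what the party itself sends on that link in the same round;
summing out the incoming messages first leaves only the party's own kernel `K`. -/
theorem tsum_node_le (K : O₁ × O₂ → ℝ≥0∞) (hK : ∑' o, K o ≤ 1)
    (φ₁ : O₁ → T₁ → ℝ≥0∞) (h₁ : ∀ o, ∑' t, φ₁ o t ≤ 1)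
    (φ₂ : O₂ → T₂ → ℝ≥0∞) (h₂ : ∀ o, ∑' t, φ₂ o t ≤ 1) :
    ∑' s : (O₁ × T₁) × (O₂ × T₂),
      K (s.1.1, s.2.1) * (φ₁ s.1.1 s.1.2 * φ₂ s.2.1 s.2.2) ≤ 1 := by
  refine le_trans ?_ hK
  rw [← (Equiv.prodProdProdComm O₁ O₂ T₁ T₂).tsum_eq, ENNReal.tsum_prod']
  refine ENNReal.tsum_le_tsum fun o => ?_
  simp only [Equiv.prodProdProdComm_apply]
  rw [ENNReal.tsum_mul_left, ENNReal.tsum_prod']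
  simp only [ENNReal.tsum_mul_left, ENNReal.tsum_mul_right]
  calc _ ≤ K o * (1 * 1) := by gcongr <;> simp [h₁, h₂]
    _ = K o := by simp

end CausalWeight

/-! ### Unique decoding of link transcripts -/

section Decoding

/-- All messages of a link history, sent after the history `p`, are codewords. -/
def CodeValid (c c' : LinkHistory → Set Msg) : LinkHistory → LinkHistory → Prop
  | _, [] => True
  | p, s :: l => s.1 ∈ c p ∧ s.2 ∈ c' p ∧ CodeValid c c' (p ++ [s]) l

theorem codeValid_concat (c c' : LinkHistory → Set Msg) (p l : LinkHistory) (s : Msg × Msg) :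
    CodeValid c c' p (l ++ [s]) ↔ CodeValid c c' p l ∧ s.1 ∈ c (p ++ l) ∧ s.2 ∈ c' (p ++ l) := by
  induction l generalizing p with
  | nil => simp [CodeValid]
  | cons a l ih => simp [CodeValid, ih, and_assoc]

theorem PrefixFree.append_inj {C : Set Msg} (hC : PrefixFree C) {u v a b : Msg} (hu : u ∈ C)
    (hv : v ∈ C) (h : u ++ a = v ++ b) : u = v := by
  rcases List.prefix_or_prefix_of_prefix (l₁ := u) (l₂ := v) (l₃ := v ++ b) ⟨a, h⟩ ⟨b, rfl⟩
    with h' | h'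
  · exact hC u hu v hv h'
  · exact (hC v hv u hu h').symm

/-- Prefix-free codes make the transcript of a link uniquely decodable, given the number of
rounds. -/
theorem CodeValid.eq_of_transcript_eq {c c' : LinkHistory → Set Msg}
    (hc : ∀ l, PrefixFree (c l)) (hc' : ∀ l, PrefixFree (c' l)) {p l l' : LinkHistory}
    (hl : CodeValid c c' p l) (hl' : CodeValid c c' p l') (hlen : l.length = l'.length)
    (h : LinkHistory.transcript l = LinkHistory.transcript l') : l = l' := by
  induction l generalizing p l' with
  | nil => exact (List.eq_nil_of_length_eq_zero hlen.symm).symm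
  | cons s l ih =>
    obtain _ | ⟨s', l'⟩ := l'
    · simp at hlen
    simp only [LinkHistory.transcript, List.map_cons, List.flatten_cons, Prod.mk.injEq] at h
    obtain ⟨h1, h2⟩ := h
    have e1 := (hc p).append_inj hl.1 hl'.1 h1
    have e2 := (hc' p).append_inj hl.2.1 hl'.2.1 h2
    have e : s = s' := Prod.ext e1 e2
    subst e
    rw [ih hl.2.2 hl'.2.2 (by simpa using hlen)
      (Prod.ext (List.append_cancel_left h1) (List.append_cancel_left h2))]

end Decoding

/-! ### Views of the parties -/

section Links

theorem length_link12 (h : History) : (link12 h).length = h.length := by simp [link12]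

theorem length_link23 (h : History) : (link23 h).length = h.length := by simp [link23]

theorem length_link31 (h : History) : (link31 h).length = h.length := by simp [link31]

/-- The messages of a party in one round on its two links; on each link, the message sent comes
first. -/
abbrev View : Type := (Msg × Msg) × (Msg × Msg)

/-- Alice's view of a round: the links to Bob and to Charlie. -/
def Round.aliceView (r : Round) : View := ((r.m12, r.m21), (r.m13, r.m31))

/-- Bob's view of a round: the links to Alice and to Charlie. -/
def Round.bobView (r : Round) : View := ((r.m21, r.m12), (r.m23, r.m32))

/-- Charlie's view of a round: the links to Alice and to Bob. -/
def Round.charlieView (r : Round) : View := ((r.m31, r.m13), (r.m32, r.m23))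

theorem map_aliceView_congr {h h' : History} (h12 : link12 h = link12 h')
    (h31 : link31 h = link31 h') : h.map Round.aliceView = h'.map Round.aliceView := by
  have key : ∀ h : History, h.map Round.aliceView =
      List.zipWith (fun a c => (a, c.swap)) (link12 h) (link31 h) := fun h => by
    simp [link12, link31, List.zipWith_map, List.zipWith_self]; exact fun _ _ => rfl
  rw [key, key, h12, h31]

theorem map_bobView_congr {h h' : History} (h12 : link12 h = link12 h')
    (h23 : link23 h = link23 h') : h.map Round.bobView = h'.map Round.bobView := by
  have key : ∀ h : History, h.map Round.bobView =
      List.zipWith (fun a c => (a.swap, c)) (link12 h) (link23 h) := fun h => by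
    simp [link12, link23, List.zipWith_map, List.zipWith_self]; exact fun _ _ => rfl
  rw [key, key, h12, h23]

theorem history_ext {h h' : History} (h12 : link12 h = link12 h') (h23 : link23 h = link23 h')
    (h31 : link31 h = link31 h') : h = h' := by
  have key : ∀ h : History, h = List.zipWith (fun (a : View) (c : Msg × Msg) =>
      (⟨a.1.1, a.1.2, c.1, c.2, a.2.2, a.2.1⟩ : Round)) (h.map Round.aliceView) (link23 h) :=
    fun h => by simp [link23, List.zipWith_map, List.zipWith_self, Round.aliceView]
  rw [key h, key h', h23, map_aliceView_congr h12 h31]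

end Links

/-! ### Factorisation of the law of a history over the parties, and exchange of inputs -/

namespace NextMessage

variable {X Y Z : Type*} (P : NextMessage X Y Z)

/-- Alice's next message distribution in terms of her view. -/
def aliceKernel (x : X) (l : List View) : PMF (Msg × Msg) :=
  P.alice x (l.map Prod.fst) (l.map fun s => s.2.swap)

/-- Bob's next message distribution in terms of his view. -/
def bobKernel (y : Y) (l : List View) : PMF (Msg × Msg) :=
  P.bob y (l.map fun s => s.1.swap) (l.map Prod.snd)

/-- Charlie's next message distribution in terms of his view. -/
def charlieKernel (l : List View) : PMF (Msg × Msg) :=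
  P.charlie (l.map fun s => s.2.swap) (l.map Prod.fst)

theorem step_apply (x : X) (y : Y) (h : History) (r : Round) :
    P.step x y h r = P.alice x (link12 h) (link31 h) (r.m12, r.m13) *
      P.bob y (link12 h) (link23 h) (r.m21, r.m23) *
      P.charlie (link23 h) (link31 h) (r.m31, r.m32) := by
  simp only [step, PMF.bind_apply, PMF.map_apply]
  rw [tsum_eq_single (r.m12, r.m13), tsum_eq_single (r.m21, r.m23), tsum_eq_single (r.m31, r.m32)]
  · simp [mul_assoc]
  · intro c hc
    rw [if_neg]
    intro e
    exact hc (by rw [e])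
  · intro b hb
    simp only [mul_eq_zero, ENNReal.tsum_eq_zero, ite_eq_right_iff]
    exact Or.inr fun c e => absurd (by rw [e]) hb
  · intro a ha
    simp only [mul_eq_zero, ENNReal.tsum_eq_zero, ite_eq_right_iff]
    exact Or.inr fun b => Or.inr fun c e => absurd (by rw [e]) ha

theorem run_apply (x : X) (y : Y) (t : ℕ) (h : History) :
    P.run x y t h = if h.length = t then causalWeight (fun h r => P.step x y h r) h else 0 := by
  classical
  induction t generalizing h with
  | zero =>
    rw [run, PMF.pure_apply]
    obtain _ | ⟨r, h⟩ := h <;> simp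
  | succ t ih =>
    rw [run, PMF.bind_apply]
    simp only [PMF.map_apply]
    induction h using List.reverseRecOn with
    | nil => simp
    | append_singleton h r _ =>
      rw [tsum_eq_single h, tsum_eq_single r]
      · simp [ih]
      · intro r' hr
        rw [if_neg]
        simpa using hr.symm
      · intro h' hh
        simp only [mul_eq_zero, ENNReal.tsum_eq_zero, ite_eq_right_iff]
        refine Or.inr fun r' e => absurd ?_ hh
        exact (List.append_inj_left' e rfl).symm

/-- Each party's contribution to the probability of a history depends only on its view. -/
theorem causalWeight_step (x : X) (y : Y) (h : History) :
    causalWeight (fun h r => P.step x y h r) h =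
      causalWeight (fun l s => P.aliceKernel x l (s.1.1, s.2.1)) (h.map Round.aliceView) *
      causalWeight (fun l s => P.bobKernel y l (s.1.1, s.2.1)) (h.map Round.bobView) *
      causalWeight (fun l s => P.charlieKernel l (s.1.1, s.2.1)) (h.map Round.charlieView) := by
  rw [← causalWeight_map, ← causalWeight_map, ← causalWeight_map, ← causalWeight_mul,
    ← causalWeight_mul]
  congr 1
  funext h r
  rw [step_apply]
  simp only [aliceKernel, bobKernel, charlieKernel, List.map_map]
  rfl

variable {P}

theorem length_of_run_ne_zero {x : X} {y : Y} {t : ℕ} {h : History} (hh : P.run x y t h ≠ 0) :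
    h.length = t := by
  by_contra hne
  exact hh (by rw [run_apply, if_neg hne])

theorem run_length_apply (x : X) (y : Y) (h : History) :
    P.run x y h.length h = causalWeight (fun h r => P.step x y h r) h := by
  rw [run_apply, if_pos rfl]

theorem PrefixFreeMessages.exists_codeValid (hP : P.PrefixFreeMessages) :
    ∃ c12 c21 c23 c32 c31 c13 : LinkHistory → Set Msg,
      (∀ l, PrefixFree (c12 l) ∧ PrefixFree (c21 l) ∧ PrefixFree (c23 l) ∧ PrefixFree (c32 l) ∧
        PrefixFree (c31 l) ∧ PrefixFree (c13 l)) ∧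
      ∀ x y t h, P.run x y t h ≠ 0 → CodeValid c12 c21 [] (link12 h) ∧
        CodeValid c23 c32 [] (link23 h) ∧ CodeValid c31 c13 [] (link31 h) := by
  obtain ⟨c12, c21, c23, c32, c31, c13, hc, hv⟩ := hP
  refine ⟨c12, c21, c23, c32, c31, c13, hc, fun x y t h hh => ?_⟩
  obtain rfl := length_of_run_ne_zero hh
  rw [run_length_apply] at hh
  induction h using List.reverseRecOn with
  | nil => simp [link12, link23, link31, CodeValid]
  | append_singleton h r ih =>
    rw [causalWeight_concat] at hh
    have h1 := left_ne_zero_of_mul hh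
    obtain ⟨i12, i23, i31⟩ := ih h1
    obtain ⟨a, b, c, d, e, f⟩ := hv x y h.length h (by
      rw [PMF.mem_support_iff, run_length_apply]; exact h1) r (right_ne_zero_of_mul hh)
    have e12 : link12 (h ++ [r]) = link12 h ++ [(r.m12, r.m21)] := by simp [link12]
    have e23 : link23 (h ++ [r]) = link23 h ++ [(r.m23, r.m32)] := by simp [link23]
    have e31 : link31 (h ++ [r]) = link31 h ++ [(r.m31, r.m13)] := by simp [link31]
    rw [e12, e23, e31, codeValid_concat, codeValid_concat, codeValid_concat]
    exact ⟨⟨i12, a, b⟩, ⟨i23, c, d⟩, ⟨i31, e, f⟩⟩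

theorem PrefixFreeMessages.link12_eq (hP : P.PrefixFreeMessages) {x x' : X} {y y' : Y} {t : ℕ}
    {h h' : History} (hh : P.run x y t h ≠ 0) (hh' : P.run x' y' t h' ≠ 0)
    (e : (transcriptsOf h).M12 = (transcriptsOf h').M12) : link12 h = link12 h' := by
  obtain ⟨c12, c21, c23, c32, c31, c13, hc, hv⟩ := hP.exists_codeValid
  exact (hv _ _ _ _ hh).1.eq_of_transcript_eq (fun l => (hc l).1) (fun l => (hc l).2.1)
    (hv _ _ _ _ hh').1
    (by rw [length_link12, length_link12, length_of_run_ne_zero hh, length_of_run_ne_zero hh']) e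

theorem PrefixFreeMessages.link23_eq (hP : P.PrefixFreeMessages) {x x' : X} {y y' : Y} {t : ℕ}
    {h h' : History} (hh : P.run x y t h ≠ 0) (hh' : P.run x' y' t h' ≠ 0)
    (e : (transcriptsOf h).M23 = (transcriptsOf h').M23) : link23 h = link23 h' := by
  obtain ⟨c12, c21, c23, c32, c31, c13, hc, hv⟩ := hP.exists_codeValid
  exact (hv _ _ _ _ hh).2.1.eq_of_transcript_eq (fun l => (hc l).2.2.1) (fun l => (hc l).2.2.2.1)
    (hv _ _ _ _ hh').2.1
    (by rw [length_link23, length_link23, length_of_run_ne_zero hh, length_of_run_ne_zero hh']) e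

theorem PrefixFreeMessages.link31_eq (hP : P.PrefixFreeMessages) {x x' : X} {y y' : Y} {t : ℕ}
    {h h' : History} (hh : P.run x y t h ≠ 0) (hh' : P.run x' y' t h' ≠ 0)
    (e : (transcriptsOf h).M31 = (transcriptsOf h').M31) : link31 h = link31 h' := by
  obtain ⟨c12, c21, c23, c32, c31, c13, hc, hv⟩ := hP.exists_codeValid
  exact (hv _ _ _ _ hh).2.2.eq_of_transcript_eq (fun l => (hc l).2.2.2.2.1)
    (fun l => (hc l).2.2.2.2.2) (hv _ _ _ _ hh').2.2
    (by rw [length_link31, length_link31, length_of_run_ne_zero hh, length_of_run_ne_zero hh']) e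

theorem PrefixFreeMessages.history_eq (hP : P.PrefixFreeMessages) {x x' : X} {y y' : Y} {t : ℕ}
    {h h' : History} (hh : P.run x y t h ≠ 0) (hh' : P.run x' y' t h' ≠ 0)
    (e : transcriptsOf h = transcriptsOf h') : h = h' :=
  history_ext (hP.link12_eq hh hh' (by rw [e])) (hP.link23_eq hh hh' (by rw [e]))
    (hP.link31_eq hh hh' (by rw [e]))

variable (P)

/-- The distribution of the transcripts after `t` rounds. -/
def runTranscripts (x : X) (y : Y) (t : ℕ) : PMF Transcripts := (P.run x y t).map transcriptsOf

variable {P}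

theorem exists_run_ne_zero {x : X} {y : Y} {t : ℕ} {m : Transcripts}
    (hm : P.runTranscripts x y t m ≠ 0) : ∃ h, transcriptsOf h = m ∧ P.run x y t h ≠ 0 := by
  rw [runTranscripts, ← PMF.mem_support_iff, PMF.mem_support_map_iff] at hm
  obtain ⟨h, hh, e⟩ := hm
  exact ⟨h, e, hh⟩

/-- Decoding makes `h` the only possible history of `t` rounds with its transcripts, so the
push-forward merges nothing. The codes do not depend on the inputs, hence `h` need only be possible
for some inputs `x'`, `y'`. -/
theorem PrefixFreeMessages.runTranscripts_eq (hP : P.PrefixFreeMessages) {x x' : X} {y y' : Y}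
    {t : ℕ} {h : History} (hh : P.run x' y' t h ≠ 0) :
    P.runTranscripts x y t (transcriptsOf h) = P.run x y t h := by
  classical
  rw [runTranscripts, PMF.map_apply, tsum_eq_single h]
  · simp
  · intro h' hne
    rw [ite_eq_right_iff]
    intro e
    by_contra hh'
    exact hne (hP.history_eq hh' hh e.symm)

/-- Exchanging Alice's inputs in two executions that agree on her links. -/
theorem PrefixFreeMessages.runTranscripts_cut_alice (hP : P.PrefixFreeMessages) (x x' : X) (y : Y)
    (t : ℕ) {m m' : Transcripts} (h12 : m.M12 = m'.M12) (h31 : m.M31 = m'.M31) :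
    P.runTranscripts x y t m * P.runTranscripts x' y t m' ≤
      P.runTranscripts x' y t m * P.runTranscripts x y t m' := by
  by_cases hm : P.runTranscripts x y t m = 0
  · simp [hm]
  by_cases hm' : P.runTranscripts x' y t m' = 0
  · simp [hm']
  obtain ⟨h, rfl, hh⟩ := exists_run_ne_zero hm
  obtain ⟨h', rfl, hh'⟩ := exists_run_ne_zero hm'
  rw [hP.runTranscripts_eq hh, hP.runTranscripts_eq hh', hP.runTranscripts_eq hh,
    hP.runTranscripts_eq hh']
  -- Alice has the same view in both histories, so exchanging `x` and `x'` only permutes the factors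
  -- of the two products.
  have e := map_aliceView_congr (hP.link12_eq hh hh' h12) (hP.link31_eq hh hh' h31)
  simp only [run_apply, length_of_run_ne_zero hh, length_of_run_ne_zero hh', if_true,
    causalWeight_step, e]
  apply le_of_eq
  ring

/-- Exchanging Bob's inputs in two executions that agree on his links. -/
theorem PrefixFreeMessages.runTranscripts_cut_bob (hP : P.PrefixFreeMessages) (x : X) (y y' : Y)
    (t : ℕ) {m m' : Transcripts} (h12 : m.M12 = m'.M12) (h23 : m.M23 = m'.M23) :
    P.runTranscripts x y t m * P.runTranscripts x y' t m' ≤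
      P.runTranscripts x y' t m * P.runTranscripts x y t m' := by
  by_cases hm : P.runTranscripts x y t m = 0
  · simp [hm]
  by_cases hm' : P.runTranscripts x y' t m' = 0
  · simp [hm']
  obtain ⟨h, rfl, hh⟩ := exists_run_ne_zero hm
  obtain ⟨h', rfl, hh'⟩ := exists_run_ne_zero hm'
  rw [hP.runTranscripts_eq hh, hP.runTranscripts_eq hh', hP.runTranscripts_eq hh,
    hP.runTranscripts_eq hh']
  have e := map_bobView_congr (hP.link12_eq hh hh' h12) (hP.link23_eq hh hh' h23)
  simp only [run_apply, length_of_run_ne_zero hh, length_of_run_ne_zero hh', if_true,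
    causalWeight_step, e]
  apply le_of_eq
  ring

end NextMessage

/-! ### From t rounds to the terminated protocol -/

namespace Protocol

variable {X Y Z : Type*} (P : Protocol X Y Z)

theorem tendsto_terminatedMass (x : X) (y : Y) (m : Transcripts) :
    Tendsto (fun t => P.terminatedMass x y t m) atTop (𝓝 (P.transcripts x y m)) :=
  tendsto_atTop_iSup (NextMessage.terminatedMass_mono x y m)

/-- The mass after `t` rounds lies between the terminated mass and the terminated mass plus the
probability of not having terminated, which tends to 0. Decoding works for a fixed number of rounds,
so facts on final transcripts are obtained as limits. -/
theorem tendsto_runTranscripts (x : X) (y : Y) (m : Transcripts) :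
    Tendsto (fun t => P.runTranscripts x y t m) atTop (𝓝 (P.transcripts x y m)) := by
  have hmono : Monotone fun t => P.terminatedProb x y t := fun s t hst => by
    simp only [← NextMessage.tsum_terminatedMass]
    exact ENNReal.tsum_le_tsum fun m => NextMessage.terminatedMass_mono x y m hst
  have hlim : Tendsto (fun t => P.terminatedProb x y t) atTop (𝓝 1) := by
    rw [← P.terminates x y]
    exact tendsto_atTop_iSup hmono
  have hsub : Tendsto (fun t => 1 - P.terminatedProb x y t) atTop (𝓝 0) := by
    have := ENNReal.Tendsto.sub (tendsto_const_nhds (x := (1 : ℝ≥0∞))) hlim (by simp)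
    simpa using this
  have hadd := (P.tendsto_terminatedMass x y m).add hsub
  rw [add_zero] at hadd
  refine tendsto_of_tendsto_of_tendsto_of_le_of_le (P.tendsto_terminatedMass x y m) hadd
    (fun t => ?_) (fun t => ?_)
  · rw [NextMessage.runTranscripts, ← PMF.toOuterMeasure_apply_singleton,
      PMF.toOuterMeasure_map_apply]
    exact MeasureTheory.measure_mono fun h hh => hh.2
  · have hc : (P.run x y t).toOuterMeasure {h | ¬ P.Terminated x y h} =
        1 - P.terminatedProb x y t := by
      let _ : MeasurableSpace History := ⊤
      have := MeasureTheory.prob_compl_eq_one_sub (μ := (P.run x y t).toMeasure)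
        (s := {h | P.Terminated x y h}) MeasurableSpace.measurableSet_top
      rwa [PMF.toMeasure_apply_eq_toOuterMeasure_apply _ MeasurableSpace.measurableSet_top,
        PMF.toMeasure_apply_eq_toOuterMeasure_apply _ MeasurableSpace.measurableSet_top] at this
    rw [← hc, NextMessage.runTranscripts, ← PMF.toOuterMeasure_apply_singleton,
      PMF.toOuterMeasure_map_apply]
    refine le_trans (MeasureTheory.measure_mono fun h hh => ?_) (MeasureTheory.measure_union_le _ _)
    by_cases ht : P.Terminated x y h
    · exact Or.inl ⟨ht, hh⟩
    · exact Or.inr ht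

/-- The exchange inequality survives the limit, and its positive left side forces both factors on
the right to be positive. -/
theorem transcripts_cut_alice {x x' : X} {y : Y} {m m' : Transcripts} (h12 : m.M12 = m'.M12)
    (h31 : m.M31 = m'.M31) (hm : P.transcripts x y m ≠ 0) (hm' : P.transcripts x' y m' ≠ 0) :
    P.transcripts x' y m ≠ 0 := by
  have h := le_of_tendsto_of_tendsto'
    (ENNReal.Tendsto.mul (P.tendsto_runTranscripts x y m) (Or.inr (PMF.apply_ne_top _ _))
      (P.tendsto_runTranscripts x' y m') (Or.inr (PMF.apply_ne_top _ _)))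
    (ENNReal.Tendsto.mul (P.tendsto_runTranscripts x' y m) (Or.inr (PMF.apply_ne_top _ _))
      (P.tendsto_runTranscripts x y m') (Or.inr (PMF.apply_ne_top _ _)))
    fun t => P.prefixFree.runTranscripts_cut_alice x x' y t h12 h31
  intro h0
  rw [h0, zero_mul, nonpos_iff_eq_zero] at h
  exact mul_ne_zero hm hm' h

theorem transcripts_cut_bob {x : X} {y y' : Y} {m m' : Transcripts} (h12 : m.M12 = m'.M12)
    (h23 : m.M23 = m'.M23) (hm : P.transcripts x y m ≠ 0) (hm' : P.transcripts x y' m' ≠ 0) :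
    P.transcripts x y' m ≠ 0 := by
  have h := le_of_tendsto_of_tendsto'
    (ENNReal.Tendsto.mul (P.tendsto_runTranscripts x y m) (Or.inr (PMF.apply_ne_top _ _))
      (P.tendsto_runTranscripts x y' m') (Or.inr (PMF.apply_ne_top _ _)))
    (ENNReal.Tendsto.mul (P.tendsto_runTranscripts x y' m) (Or.inr (PMF.apply_ne_top _ _))
      (P.tendsto_runTranscripts x y m') (Or.inr (PMF.apply_ne_top _ _)))
    fun t => P.prefixFree.runTranscripts_cut_bob x y y' t h12 h23
  intro h0
  rw [h0, zero_mul, nonpos_iff_eq_zero] at h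
  exact mul_ne_zero hm hm' h

end Protocol

/-! ### Fatou's lemma for sums and limits along ultrafilters -/

section Limits

variable {ι : Type*}

theorem tsum_le_of_tendsto {T : Type*} {l : Filter T} [l.NeBot] {g : T → ι → ℝ≥0∞}
    {G : ι → ℝ≥0∞} {s : T → ℝ≥0∞} {L : ℝ≥0∞} (hg : ∀ i, Tendsto (fun t => g t i) l (𝓝 (G i)))
    (hs : Tendsto s l (𝓝 L)) (hle : ∀ t, ∑' i, g t i ≤ s t) : ∑' i, G i ≤ L := by
  rw [ENNReal.tsum_eq_iSup_sum]
  refine iSup_le fun F => ?_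
  exact le_of_tendsto_of_tendsto' (tendsto_finsetSum F fun i _ => hg i) hs
    fun t => (ENNReal.sum_le_tsum F).trans (hle t)

theorem exists_tendsto_ultrafilter {T : Type*} (l : Ultrafilter T) (g : T → ι → ℝ≥0∞) :
    ∃ G : ι → ℝ≥0∞, ∀ i, Tendsto (fun t => g t i) l (𝓝 (G i)) :=
  ⟨fun i => (l.map fun t => g t i).lim, fun i => (l.map fun t => g t i).le_nhds_lim⟩

end Limits

/-! ### Subprobability weights on the views of one party -/

section Nodes

variable {I : Type*}

theorem tsum_mixture_node_le (q : PMF I) (κ : I → List View → PMF (Msg × Msg))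
    (φ₁ φ₂ : List View → Msg → Msg → ℝ≥0∞) (h₁ : ∀ l o, ∑' t, φ₁ l o t ≤ 1)
    (h₂ : ∀ l o, ∑' t, φ₂ l o t ≤ 1) (t : ℕ) :
    ∑' l : List View, (if l.length = t then ∑' i, q i * causalWeight (fun l s =>
      κ i l (s.1.1, s.2.1) * (φ₁ l s.1.1 s.1.2 * φ₂ l s.2.1 s.2.2)) l else 0) ≤ 1 := by
  refine (tsum_length_le (fun l => ∑' i, q i * causalWeight (fun l s =>
      κ i l (s.1.1, s.2.1) * (φ₁ l s.1.1 s.1.2 * φ₂ l s.2.1 s.2.2)) l) (fun l => ?_) t).trans ?_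
  · rw [ENNReal.tsum_comm]
    refine ENNReal.tsum_le_tsum fun i => ?_
    simp only [causalWeight_concat]
    rw [ENNReal.tsum_mul_left, ENNReal.tsum_mul_left]
    gcongr
    refine le_trans ?_ (mul_one _).le
    gcongr
    exact tsum_node_le (κ i l) (κ i l).tsum_coe.le _ (h₁ l) _ (h₂ l)
  · simp

theorem causalWeight_node {σ τ τ' : Type*} (κ : List σ → σ → ℝ≥0∞) (k : List τ → τ → ℝ≥0∞)
    (k' : List τ' → τ' → ℝ≥0∞) (f : σ → τ) (g : σ → τ') (l : List σ) :
    causalWeight (fun l s => κ l s * (k (l.map f) (f s) * k' (l.map g) (g s))) l =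
      causalWeight κ l * (causalWeight k (l.map f) * causalWeight k' (l.map g)) := by
  rw [causalWeight_mul, causalWeight_mul, causalWeight_map, causalWeight_map]

open scoped Classical in
/-- The image of the part of a weight supported on lists of length `t`. -/
def pushLength {σ τ : Type*} (t : ℕ) (F : List σ → τ) (w : List σ → ℝ≥0∞) (b : τ) : ℝ≥0∞ :=
  ∑' l, if b = F l then (if l.length = t then w l else 0) else 0

theorem tsum_pushLength {σ τ : Type*} (t : ℕ) (F : List σ → τ) (w : List σ → ℝ≥0∞) :
    ∑' b, pushLength t F w b = ∑' l, if l.length = t then w l else 0 := by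
  classical
  unfold pushLength
  rw [ENNReal.tsum_comm]
  exact tsum_congr fun l => tsum_ite_eq _ _

theorem le_pushLength {σ τ : Type*} {t : ℕ} {F : List σ → τ} {w : List σ → ℝ≥0∞} {l : List σ}
    {b : τ} (hl : l.length = t) (hb : b = F l) : w l ≤ pushLength t F w b := by
  classical
  subst hl hb
  unfold pushLength
  exact (by simp : w l ≤ _).trans (ENNReal.le_tsum l)

end Nodes

/-! ### Transcripts under independent inputs -/

section Mixture

variable {X Y α β : Type*} (qX : PMF X) (qY : PMF Y)

/-- The mixture of a family of distributions under independent inputs. -/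
def mixture (f : X → Y → PMF α) : PMF α := qX.bind fun x => qY.bind fun y => f x y

theorem mixture_apply (f : X → Y → PMF α) (a : α) :
    mixture qX qY f a = ∑' x, ∑' y, qX x * qY y * f x y a := by
  simp only [mixture, PMF.bind_apply, ← ENNReal.tsum_mul_left, mul_assoc]

theorem mixture_map (f : X → Y → PMF α) (φ : α → β) :
    (mixture qX qY f).map φ = mixture qX qY fun x y => (f x y).map φ := by
  simp only [mixture, PMF.map_bind]

theorem mixture_map_apply [DecidableEq β] (f : X → Y → PMF α) (φ : α → β) (b : β) :
    (mixture qX qY f).map φ b = ∑' i : X × Y × α,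
      qX i.1 * qY i.2.1 * (f i.1 i.2.1 i.2.2 * if b = φ i.2.2 then 1 else 0) := by
  rw [mixture_map, mixture_apply, ENNReal.tsum_prod']
  refine tsum_congr fun x => ?_
  rw [ENNReal.tsum_prod']
  refine tsum_congr fun y => ?_
  dsimp only
  rw [ENNReal.tsum_mul_left, PMF.map_apply]
  congr 1
  refine tsum_congr fun a => ?_
  split_ifs with h1 <;> simp

/-- Fatou: mass may escape in the limit, so only this direction is available. It suffices, because
the marginals stand on the smaller side of the correlation inequality. -/
theorem mixture_map_le_of_tendsto {T : Type*} {l : Filter T} [l.NeBot] {f : T → X → Y → PMF α}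
    {f' : X → Y → PMF α} (hf : ∀ x y a, Tendsto (fun t => f t x y a) l (𝓝 (f' x y a)))
    (φ : α → β) (b : β) {L : ℝ≥0∞}
    (hL : Tendsto (fun t => (mixture qX qY (f t)).map φ b) l (𝓝 L)) :
    (mixture qX qY f').map φ b ≤ L := by
  classical
  rw [mixture_map_apply]
  refine tsum_le_of_tendsto (g := fun t i => qX i.1 * qY i.2.1 *
    (f t i.1 i.2.1 i.2.2 * if b = φ i.2.2 then 1 else 0)) (fun i => ?_) hL
    fun t => (mixture_map_apply qX qY (f t) φ b).ge
  refine ENNReal.Tendsto.const_mul (ENNReal.Tendsto.mul_const (hf _ _ _) (Or.inr ?_))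
    (Or.inr (ENNReal.mul_ne_top (PMF.apply_ne_top _ _) (PMF.apply_ne_top _ _)))
  split_ifs <;> simp

end Mixture

/-! ### The correlation inequality -/

namespace NextMessage

variable {X Y Z : Type*} (P : NextMessage X Y Z) (qX : PMF X) (qY : PMF Y)

/-- The weight of a history under independent inputs. -/
def historyWeight (h : History) : ℝ≥0∞ :=
  ∑' x, ∑' y, qX x * qY y * causalWeight (fun h r => P.step x y h r) h

theorem tsum_historyWeight_concat_le (h : History) :
    ∑' r, P.historyWeight qX qY (h ++ [r]) ≤ P.historyWeight qX qY h := by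
  unfold historyWeight
  rw [ENNReal.tsum_comm]
  refine ENNReal.tsum_le_tsum fun x => ?_
  rw [ENNReal.tsum_comm]
  refine ENNReal.tsum_le_tsum fun y => ?_
  simp only [causalWeight_concat]
  rw [ENNReal.tsum_mul_left, ENNReal.tsum_mul_left, PMF.tsum_coe, mul_one]

theorem historyWeight_nil : P.historyWeight qX qY [] = 1 := by
  simp [historyWeight, ENNReal.tsum_mul_left]

/-- Independence of the inputs is essential here: the double sum splits into a sum over `x` of
Alice's factor and a sum over `y` of Bob's. -/
theorem historyWeight_eq (h : History) : P.historyWeight qX qY h =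
    (∑' x, qX x * causalWeight (fun l s => P.aliceKernel x l (s.1.1, s.2.1))
      (h.map Round.aliceView)) *
    (∑' y, qY y * causalWeight (fun l s => P.bobKernel y l (s.1.1, s.2.1))
      (h.map Round.bobView)) *
    causalWeight (fun l s => P.charlieKernel l (s.1.1, s.2.1)) (h.map Round.charlieView) := by
  simp only [historyWeight, causalWeight_step]
  rw [← ENNReal.tsum_mul_right, ← ENNReal.tsum_mul_right]
  refine tsum_congr fun x => ?_
  rw [← ENNReal.tsum_mul_left, ← ENNReal.tsum_mul_right]
  refine tsum_congr fun y => ?_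
  ring

/-- For independent inputs, the product of the three link weights and the joint weight is bounded by
a product of three causal subprobability weights, one for each party: the party follows the
protocol, and its partners' messages follow the marginal law of the respective link. -/
theorem exists_view_weights : ∃ w u v : List View → ℝ≥0∞,
    (∀ t, ∑' l, (if l.length = t then w l else 0) ≤ 1) ∧
    (∀ t, ∑' l, (if l.length = t then u l else 0) ≤ 1) ∧
    (∀ t, ∑' l, (if l.length = t then v l else 0) ≤ 1) ∧
    ∀ h, pushWeight (P.historyWeight qX qY) (fun r => (r.m12, r.m21)) (link12 h) *
      pushWeight (P.historyWeight qX qY) (fun r => (r.m23, r.m32)) (link23 h) *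
      pushWeight (P.historyWeight qX qY) (fun r => (r.m31, r.m13)) (link31 h) *
      P.historyWeight qX qY h ≤
    w (h.map Round.aliceView) * u (h.map Round.bobView) * v (h.map Round.charlieView) := by
  have dir := fun (f : Round → Msg × Msg) =>
    exists_directional_weights (pushWeight (P.historyWeight qX qY) f)
      (by rw [pushWeight_nil, historyWeight_nil])
      (tsum_pushWeight_concat_le _ (P.tsum_historyWeight_concat_le qX qY) f)
  obtain ⟨a, a', ha, ha', haa⟩ := dir fun r => (r.m12, r.m21)
  obtain ⟨b, b', hb, hb', hbb⟩ := dir fun r => (r.m23, r.m32)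
  obtain ⟨c, c', hc, hc', hcc⟩ := dir fun r => (r.m31, r.m13)
  -- Every directional weight goes to the receiver of the message. The conditional ones `a'`, `b'`,
  -- `c'` also depend on the opposite message of the same round; by the cyclic orientation of the
  -- links that message is sent by the receiver itself (Alice, Bob, Charlie respectively), as
  -- `tsum_node_le` allows.
  refine ⟨_, _, _, tsum_mixture_node_le qX P.aliceKernel
      (fun l o t => a' (l.map Prod.fst) o t) (fun l _ t => c (l.map fun s => s.2.swap) t)
      (fun l o => ha' _ _) (fun l o => hc _),
    tsum_mixture_node_le qY P.bobKernel
      (fun l _ t => a (l.map fun s => s.1.swap) t) (fun l o t => b' (l.map Prod.snd) o t)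
      (fun l o => ha _) (fun l o => hb' _ _),
    tsum_mixture_node_le (PMF.pure ()) (fun _ => P.charlieKernel)
      (fun l o t => c' (l.map Prod.fst) o t) (fun l _ t => b (l.map fun s => s.2.swap) t)
      (fun l o => hc' _ _) (fun l o => hb _), fun h => ?_⟩
  have eA := fun x => causalWeight_node
    (fun l (s : View) => P.aliceKernel x l (s.1.1, s.2.1)) (fun l s => a' l s.1 s.2)
    (fun l s => c l s.1) Prod.fst (fun s => s.2.swap) (h.map Round.aliceView)
  have eB := fun y => causalWeight_node
    (fun l (s : View) => P.bobKernel y l (s.1.1, s.2.1)) (fun l s => a l s.1)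
    (fun l s => b' l s.1 s.2) (fun s => s.1.swap) Prod.snd (h.map Round.bobView)
  have eC := causalWeight_node
    (fun l (s : View) => P.charlieKernel l (s.1.1, s.2.1)) (fun l s => c' l s.1 s.2)
    (fun l s => b l s.1) Prod.fst (fun s => s.2.swap) (h.map Round.charlieView)
  have l12 : link12 h = (h.map Round.aliceView).map Prod.fst := by
    rw [List.map_map]; rfl
  have l12' : link12 h = (h.map Round.bobView).map fun s => s.1.swap := by
    rw [List.map_map]; rfl
  have l23 : link23 h = (h.map Round.bobView).map Prod.snd := by
    rw [List.map_map]; rfl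
  have l23' : link23 h = (h.map Round.charlieView).map fun s => s.2.swap := by
    rw [List.map_map]; rfl
  have l31 : link31 h = (h.map Round.charlieView).map Prod.fst := by
    rw [List.map_map]; rfl
  have l31' : link31 h = (h.map Round.aliceView).map fun s => s.2.swap := by
    rw [List.map_map]; rfl
  rw [← l12, ← l31'] at eA
  rw [← l12', ← l23] at eB
  rw [← l31, ← l23'] at eC
  simp only [Prod.fst_swap] at eA eB eC
  rw [tsum_fintype (L := .unconditional Unit)]
  simp only [eA, eB, eC, Finset.univ_unique, Finset.sum_singleton, PMF.pure_apply, if_true,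
    one_mul]
  simp only [← mul_assoc, ENNReal.tsum_mul_right]
  rw [historyWeight_eq]
  refine (mul_le_mul_left (mul_le_mul' (mul_le_mul' (haa _) (hbb _)) (hcc _)) _).trans ?_
  apply le_of_eq
  ring

theorem mixture_run_apply (t : ℕ) (h : History) :
    mixture qX qY (fun x y => P.run x y t) h =
      if h.length = t then P.historyWeight qX qY h else 0 := by
  rw [mixture_apply]
  simp only [run_apply, historyWeight]
  split_ifs <;> simp

variable {P}

theorem exists_run_of_mixture_run {t : ℕ} {h : History}
    (hh : mixture qX qY (fun x y => P.run x y t) h ≠ 0) : ∃ x y, P.run x y t h ≠ 0 := by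
  by_contra! hne
  exact hh (by simp [mixture_apply, hne])

/-- By `hinj`, every possible history with the same transcript of the link as `h` also has the same
link history, so it is counted in `pushWeight`. -/
theorem mixture_link_le {t : ℕ} {τ : Type*} (f : Round → Msg × Msg) (g : Transcripts → τ)
    {h : History}
    (hinj : ∀ h', mixture qX qY (fun x y => P.run x y t) h' ≠ 0 →
      g (transcriptsOf h) = g (transcriptsOf h') → h'.map f = h.map f) :
    (mixture qX qY fun x y => P.runTranscripts x y t).map g (g (transcriptsOf h)) ≤
      pushWeight (P.historyWeight qX qY) f (h.map f) := by
  classical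
  unfold runTranscripts
  rw [← mixture_map, PMF.map_comp, PMF.map_apply, pushWeight]
  refine ENNReal.tsum_le_tsum fun h' => ?_
  by_cases h0 : mixture qX qY (fun x y => P.run x y t) h' = 0
  · simp [h0]
  split_ifs with h1 h2
  · rw [mixture_run_apply]
    split_ifs <;> simp
  · exact absurd (hinj h' h0 h1) h2
  · exact zero_le
  · exact le_rfl

theorem PrefixFreeMessages.exists_runTranscripts_weights (hP : P.PrefixFreeMessages) (t : ℕ) :
    ∃ w u v : Transcript × Transcript → ℝ≥0∞,
      ∑' a, w a ≤ 1 ∧ ∑' a, u a ≤ 1 ∧ ∑' a, v a ≤ 1 ∧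
      ∀ m, (mixture qX qY fun x y => P.runTranscripts x y t).map Transcripts.M12 m.M12 *
        (mixture qX qY fun x y => P.runTranscripts x y t).map Transcripts.M23 m.M23 *
        (mixture qX qY fun x y => P.runTranscripts x y t).map Transcripts.M31 m.M31 *
        (mixture qX qY fun x y => P.runTranscripts x y t).map id m ≤
      w (m.M12, m.M31) * u (m.M12, m.M23) * v (m.M23, m.M31) := by
  obtain ⟨w, u, v, hw, hu, hv, hle⟩ := P.exists_view_weights qX qY
  refine ⟨pushLength t (fun l => (LinkHistory.transcript (l.map Prod.fst),
      LinkHistory.transcript (l.map fun s => s.2.swap))) w,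
    pushLength t (fun l => (LinkHistory.transcript (l.map fun s => s.1.swap),
      LinkHistory.transcript (l.map Prod.snd))) u,
    pushLength t (fun l => (LinkHistory.transcript (l.map fun s => s.2.swap),
      LinkHistory.transcript (l.map Prod.fst))) v,
    (tsum_pushLength _ _ _).trans_le (hw t), (tsum_pushLength _ _ _).trans_le (hu t),
    (tsum_pushLength _ _ _).trans_le (hv t), fun m => ?_⟩
  by_cases hm : (mixture qX qY fun x y => P.runTranscripts x y t).map id m = 0
  · simp [hm]
  obtain ⟨h, hh, rfl⟩ : ∃ h, mixture qX qY (fun x y => P.run x y t) h ≠ 0 ∧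
      transcriptsOf h = m := by
    have hm' := (PMF.mem_support_iff _ _).2 hm
    rw [PMF.map_id] at hm'
    unfold runTranscripts at hm'
    rw [← mixture_map, PMF.mem_support_map_iff] at hm'
    exact hm'
  obtain ⟨x, y, hxy⟩ := exists_run_of_mixture_run qX qY hh
  have hlen := length_of_run_ne_zero hxy
  have e12 := mixture_link_le qX qY (fun r => (r.m12, r.m21)) Transcripts.M12 fun h' h0 e => by
    obtain ⟨x', y', hxy'⟩ := exists_run_of_mixture_run qX qY h0
    exact hP.link12_eq hxy' hxy e.symm
  have e23 := mixture_link_le qX qY (fun r => (r.m23, r.m32)) Transcripts.M23 fun h' h0 e => by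
    obtain ⟨x', y', hxy'⟩ := exists_run_of_mixture_run qX qY h0
    exact hP.link23_eq hxy' hxy e.symm
  have e31 := mixture_link_le qX qY (fun r => (r.m31, r.m13)) Transcripts.M31 fun h' h0 e => by
    obtain ⟨x', y', hxy'⟩ := exists_run_of_mixture_run qX qY h0
    exact hP.link31_eq hxy' hxy e.symm
  have e : (mixture qX qY fun x y => P.runTranscripts x y t).map id (transcriptsOf h) =
      P.historyWeight qX qY h := by
    rw [PMF.map_id, mixture_apply]
    have := mixture_run_apply P qX qY t h
    rw [mixture_apply, if_pos hlen] at this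
    rw [← this]
    simp only [hP.runTranscripts_eq hxy]
  rw [e]
  refine (mul_le_mul_left (mul_le_mul' (mul_le_mul' e12 e23) e31) _).trans ((hle h).trans ?_)
  have hl : ∀ f : Round → View, (h.map f).length = t := fun f => by rw [List.length_map, hlen]
  exact mul_le_mul' (mul_le_mul' (le_pushLength (hl _) (by simp only [List.map_map]; rfl))
    (le_pushLength (hl _) (by simp only [List.map_map]; rfl)))
    (le_pushLength (hl _) (by simp only [List.map_map]; rfl))

end NextMessage

namespace Protocol

variable {X Y Z : Type*} (P : Protocol X Y Z) (qX : PMF X) (qY : PMF Y)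

/-- The correlation inequality for the transcripts of a protocol with independent inputs. It implies
that the interaction information of the three transcripts is nonnegative. -/
theorem exists_transcripts_weights : ∃ w u v : Transcript × Transcript → ℝ≥0∞,
    ∑' a, w a ≤ 1 ∧ ∑' a, u a ≤ 1 ∧ ∑' a, v a ≤ 1 ∧
    ∀ m, (mixture qX qY P.transcripts).map Transcripts.M12 m.M12 *
      (mixture qX qY P.transcripts).map Transcripts.M23 m.M23 *
      (mixture qX qY P.transcripts).map Transcripts.M31 m.M31 *
      mixture qX qY P.transcripts m ≤
    w (m.M12, m.M31) * u (m.M12, m.M23) * v (m.M23, m.M31) := by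
  choose w u v hw hu hv hle using P.prefixFree.exists_runTranscripts_weights qX qY
  -- The weights for `t` rounds need not converge, but along an ultrafilter they have limits by
  -- compactness of `[0, ∞]`; it refines `atTop`, so the laws of the transcripts keep theirs.
  let F : Ultrafilter ℕ := Filter.hyperfilter ℕ
  have hF : (F : Filter ℕ) ≤ atTop := Nat.hyperfilter_le_atTop
  obtain ⟨w', hw'⟩ := exists_tendsto_ultrafilter F w
  obtain ⟨u', hu'⟩ := exists_tendsto_ultrafilter F u
  obtain ⟨v', hv'⟩ := exists_tendsto_ultrafilter F v
  have hw1 := tsum_le_of_tendsto hw' tendsto_const_nhds hw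
  have hu1 := tsum_le_of_tendsto hu' tendsto_const_nhds hu
  have hv1 := tsum_le_of_tendsto hv' tendsto_const_nhds hv
  have ft : ∀ {f : Transcript × Transcript → ℝ≥0∞} (_ : ∑' a, f a ≤ 1) a, f a ≠ ∞ :=
    fun h a => ne_top_of_le_ne_top ENNReal.one_ne_top ((ENNReal.le_tsum a).trans h)
  refine ⟨w', u', v', hw1, hu1, hv1, fun m => ?_⟩
  have key : ∀ {τ : Type} (φ : Transcripts → τ) (b : τ), ∃ L ≤ 1,
      Tendsto (fun t => (mixture qX qY fun x y => P.runTranscripts x y t).map φ b) F (𝓝 L) ∧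
      (mixture qX qY P.transcripts).map φ b ≤ L := fun φ b => by
    obtain ⟨L, hL⟩ := exists_tendsto_ultrafilter F fun t (_ : Unit) =>
      (mixture qX qY fun x y => P.runTranscripts x y t).map φ b
    exact ⟨L (), le_of_tendsto' (hL ()) fun t => PMF.coe_le_one _ _, hL (),
      mixture_map_le_of_tendsto qX qY
        (fun x y a => (P.tendsto_runTranscripts x y a).mono_left hF) φ b (hL ())⟩
  obtain ⟨L12, b12, t12, h12⟩ := key Transcripts.M12 m.M12
  obtain ⟨L23, b23, t23, h23⟩ := key Transcripts.M23 m.M23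
  obtain ⟨L31, b31, t31, h31⟩ := key Transcripts.M31 m.M31
  obtain ⟨L, b, t, h⟩ := key id m
  rw [PMF.map_id] at h
  have n12 := ne_top_of_le_ne_top ENNReal.one_ne_top b12
  have n23 := ne_top_of_le_ne_top ENNReal.one_ne_top b23
  have n31 := ne_top_of_le_ne_top ENNReal.one_ne_top b31
  have n := ne_top_of_le_ne_top ENNReal.one_ne_top b
  refine (mul_le_mul' (mul_le_mul' (mul_le_mul' h12 h23) h31) h).trans ?_
  have m1 := ENNReal.Tendsto.mul t12 (Or.inr n23) t23 (Or.inr n12)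
  have m2 := ENNReal.Tendsto.mul m1 (Or.inr n31) t31 (Or.inr (ENNReal.mul_ne_top n12 n23))
  have m3 := ENNReal.Tendsto.mul m2 (Or.inr n) t
    (Or.inr (ENNReal.mul_ne_top (ENNReal.mul_ne_top n12 n23) n31))
  have r1 := ENNReal.Tendsto.mul (hw' (m.M12, m.M31)) (Or.inr (ft hu1 _)) (hu' (m.M12, m.M23))
    (Or.inr (ft hw1 _))
  have r2 := ENNReal.Tendsto.mul r1 (Or.inr (ft hv1 _)) (hv' (m.M23, m.M31))
    (Or.inr (ENNReal.mul_ne_top (ft hw1 _) (ft hu1 _)))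
  exact le_of_tendsto_of_tendsto' m3 r2 fun t => hle t m

end Protocol

/-! ### Mass bounds and entropy -/

section Discrete

variable {Ω α β γ : Type*}

theorem tsum_map_mul (κ : PMF α) (φ : α → β) (F : β → ℝ≥0∞) :
    ∑' b, κ.map φ b * F b = ∑' a, κ a * F (φ a) := by
  classical
  simp only [PMF.map_apply, ← ENNReal.tsum_mul_right]
  rw [ENNReal.tsum_comm]
  refine tsum_congr fun a => ?_
  rw [tsum_eq_single (φ a)]
  · simp
  · intro b hb
    simp [hb]

theorem le_map_apply (κ : PMF α) (φ : α → β) (a : α) : κ a ≤ κ.map φ (φ a) := by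
  classical
  rw [PMF.map_apply]
  exact (by simp : κ a ≤ _).trans (ENNReal.le_tsum a)

theorem map_snd_apply (κ : PMF (α × β)) (b : β) : κ.map Prod.snd b = ∑' a, κ (a, b) := by
  classical
  rw [PMF.map_apply, ENNReal.tsum_prod']
  refine tsum_congr fun a => ?_
  rw [tsum_eq_single b]
  · simp
  · intro b' hb
    simp [hb.symm]

theorem tsum_mul_const (κ : PMF α) (c : ℝ≥0∞) : ∑' a, κ a * c = c := by
  rw [ENNReal.tsum_mul_right, PMF.tsum_coe, one_mul]

/-- Distributions with disjoint supports and common marginals have spread-out marginals. -/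
theorem card_mul_map_snd_le_one {ι : Type*} [Fintype ι] (G : ι → PMF (α × β)) (ν : PMF α)
    (μ : PMF β) (h₁ : ∀ i, (G i).map Prod.fst = ν) (h₂ : ∀ i, (G i).map Prod.snd = μ)
    (hd : ∀ i j a, G i a ≠ 0 → G j a ≠ 0 → i = j) (b : β) : μ b * Fintype.card ι ≤ 1 := by
  classical
  calc μ b * Fintype.card ι = ∑ i, (G i).map Prod.snd b := by
        simp [h₂, mul_comm]
    _ = ∑' a, ∑ i, G i (a, b) := by
        simp only [map_snd_apply]
        exact (Summable.tsum_finsetSum fun i _ => ENNReal.summable).symm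
    _ ≤ ∑' a, ν a := by
        refine ENNReal.tsum_le_tsum fun a => ?_
        -- At most one `i` charges `(a, b)`, with mass at most the first marginal `ν a`.
        by_cases h : ∃ i, G i (a, b) ≠ 0
        · obtain ⟨i, hi⟩ := h
          rw [Finset.sum_eq_single i]
          · rw [← h₁ i]
            exact le_map_apply (G i) Prod.fst (a, b)
          · intro j _ hj
            by_contra hne
            exact hj (hd j i _ hne hi)
          · simp
        · push Not at h
          simp [h]
    _ = 1 := ν.tsum_coe

theorem mul_logb_le_of_mul_le {p q N : ℝ} (hp : 0 ≤ p) (hN : 0 < N)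
    (h : p * N ≤ q) : p * Real.logb 2 N ≤ -(p * Real.logb 2 (p / q)) := by
  rcases hp.eq_or_lt with rfl | hp
  · simp
  rw [← mul_neg, ← Real.logb_inv, inv_div]
  refine mul_le_mul_of_nonneg_left (Real.logb_le_logb_of_le (by norm_num) hN ?_) hp.le
  rwa [le_div_iff₀ hp, mul_comm]

theorem entropy_ge (μ : PMF Ω) (A : Ω → α) {N : ℕ} (hN : 0 < N)
    (h : ∀ a, μ.map A a * N ≤ 1) : ENNReal.ofReal (Real.logb 2 N) ≤ entropy μ A := by
  rw [← tsum_mul_const (μ.map A) (ENNReal.ofReal (Real.logb 2 N)), entropy]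
  refine ENNReal.tsum_le_tsum fun a => ?_
  have hfin := PMF.apply_ne_top (μ.map A) a
  rw [← ENNReal.ofReal_toReal hfin, ← ENNReal.ofReal_mul ENNReal.toReal_nonneg,
    ENNReal.ofReal_toReal hfin]
  refine ENNReal.ofReal_le_ofReal ?_
  have := mul_logb_le_of_mul_le (N := N) (ENNReal.toReal_nonneg (a := μ.map A a))
    (by exact_mod_cast hN) (by simpa using ENNReal.toReal_mono (by simp) (h a))
  simpa using this

theorem condEntropy_ge (μ : PMF Ω) (A : Ω → α) (B : Ω → β) {N : ℕ} (hN : 0 < N)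
    (h : ∀ a b, μ.map (fun ω => (A ω, B ω)) (a, b) * N ≤ μ.map B b) :
    ENNReal.ofReal (Real.logb 2 N) ≤ condEntropy μ A B := by
  rw [← tsum_mul_const (μ.map fun ω => (A ω, B ω)) (ENNReal.ofReal (Real.logb 2 N)),
    condEntropy, ENNReal.tsum_prod', ENNReal.tsum_comm]
  refine ENNReal.tsum_le_tsum fun b => ENNReal.tsum_le_tsum fun a => ?_
  have hfin := PMF.apply_ne_top (μ.map fun ω => (A ω, B ω)) (a, b)
  rw [← ENNReal.ofReal_toReal hfin, ← ENNReal.ofReal_mul ENNReal.toReal_nonneg,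
    ENNReal.ofReal_toReal hfin]
  refine ENNReal.ofReal_le_ofReal (mul_logb_le_of_mul_le ENNReal.toReal_nonneg
    (by exact_mod_cast hN) ?_)
  simpa using ENNReal.toReal_mono (PMF.apply_ne_top _ _) (h a b)

theorem condEntropy_le (μ : PMF Ω) (A : Ω → α) (B : Ω → β) {N : ℕ}
    (h : ∀ a b, μ.map (fun ω => (A ω, B ω)) (a, b) ≠ 0 →
      μ.map B b ≤ μ.map (fun ω => (A ω, B ω)) (a, b) * N) :
    condEntropy μ A B ≤ ENNReal.ofReal (Real.logb 2 N) := by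
  rw [← tsum_mul_const (μ.map fun ω => (A ω, B ω)) (ENNReal.ofReal (Real.logb 2 N)),
    condEntropy, ENNReal.tsum_prod', ENNReal.tsum_comm (α := α)]
  refine ENNReal.tsum_le_tsum fun b => ENNReal.tsum_le_tsum fun a => ?_
  have hfin := PMF.apply_ne_top (μ.map fun ω => (A ω, B ω)) (a, b)
  by_cases hab : μ.map (fun ω => (A ω, B ω)) (a, b) = 0
  · simp [hab]
  have hpos := ENNReal.toReal_pos hab hfin
  have hbpos : 0 < (μ.map B b).toReal := by
    refine ENNReal.toReal_pos (fun hb => hab ?_) (PMF.apply_ne_top _ _)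
    have := le_map_apply (μ.map fun ω => (A ω, B ω)) Prod.snd (a, b)
    rw [PMF.map_comp] at this
    exact nonpos_iff_eq_zero.1 (this.trans_eq hb)
  rw [← ENNReal.ofReal_toReal hfin, ← ENNReal.ofReal_mul ENNReal.toReal_nonneg,
    ENNReal.ofReal_toReal hfin]
  refine ENNReal.ofReal_le_ofReal ?_
  rw [← mul_neg, ← Real.logb_inv, inv_div]
  refine mul_le_mul_of_nonneg_left (Real.logb_le_logb_of_le (by norm_num) (by positivity) ?_)
    hpos.le
  rw [div_le_iff₀ hpos, mul_comm]
  simpa using ENNReal.toReal_mono (ENNReal.mul_ne_top hfin (by simp)) (h a b hab)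

end Discrete

/-! ### Markov chains as equalities of conditional laws -/

section Markov

variable {I T Ω α β γ : Type*} (p : PMF I) (κ : I → PMF T) (o : I → T → Ω)

theorem bind_map_apply_prod [DecidableEq β] (A : Ω → α) (B : Ω → β) {φ : T → α} {b : I → β}
    (hA : ∀ i t, A (o i t) = φ t) (hB : ∀ i t, B (o i t) = b i) (a : α) (e : β) :
    ((p.bind fun i => (κ i).map (o i)).map fun ω => (A ω, B ω)) (a, e) =
      ∑' i, if e = b i then p i * (κ i).map φ a else 0 := by
  classical
  rw [PMF.map_bind, PMF.bind_apply]
  refine tsum_congr fun i => ?_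
  rw [PMF.map_comp, PMF.map_apply, PMF.map_apply]
  simp only [Function.comp_def, hA, hB, Prod.mk.injEq]
  by_cases h : e = b i <;> simp [h]

theorem bind_map_apply [DecidableEq β] (B : Ω → β) {b : I → β} (hB : ∀ i t, B (o i t) = b i)
    (e : β) : ((p.bind fun i => (κ i).map (o i)).map B) e = ∑' i, if e = b i then p i else 0 := by
  rw [PMF.map_bind, PMF.bind_apply]
  refine tsum_congr fun i => ?_
  have : B ∘ o i = Function.const T (b i) := funext fun t => hB i t
  rw [PMF.map_comp, this, PMF.map_const, PMF.pure_apply]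
  split_ifs <;> simp

variable {p κ o}

/-- The pair `(b k, c k)` identifies `k`, so the Markov identity at this pair contains the law at
`k` alone, and apart from `p k` everything else depends on `k` only through `b k`. Cancelling `p k ≠
0` leaves a law determined by `b k`. -/
theorem MarkovChain.map_eq {A : Ω → α} {B : Ω → β} {C : Ω → γ}
    (hM : MarkovChain (p.bind fun i => (κ i).map (o i)) A B C) {φ : T → α} {b : I → β} {c : I → γ}
    (hA : ∀ i t, A (o i t) = φ t) (hB : ∀ i t, B (o i t) = b i) (hC : ∀ i t, C (o i t) = c i)
    (hp : ∀ i, p i ≠ 0) (hinj : ∀ i j, b i = b j → c i = c j → i = j) {i j : I} (hij : b i = b j) :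
    (κ i).map φ = (κ j).map φ := by
  classical
  have key : ∀ k a, p k * (κ k).map φ a * (∑' i, if b k = b i then p i else 0) =
      (∑' i, if b k = b i then p i * (κ i).map φ a else 0) * p k := fun k a => by
    have := hM a (b k) (c k)
    have hBC : ∀ i t, (B (o i t), C (o i t)) = (b i, c i) := fun i t => by rw [hB, hC]
    have hu : ∀ i, ((b k, c k) = (b i, c i)) ↔ i = k := fun i => by
      constructor
      · intro h
        rw [Prod.mk.injEq] at h
        exact (hinj k i h.1 h.2).symm
      · rintro rfl
        rfl
    rw [bind_map_apply_prod p κ o A (fun ω => (B ω, C ω)) hA hBC, bind_map_apply p κ o B hB,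
      bind_map_apply_prod p κ o A B hA hB, bind_map_apply p κ o (fun ω => (B ω, C ω)) hBC] at this
    simpa only [hu, tsum_ite_eq] using this
  have hle : (∑' i', if b j = b i' then p i' else 0) ≤ 1 := by
    rw [← p.tsum_coe]
    refine ENNReal.tsum_le_tsum fun i => ?_
    split_ifs <;> simp
  have hne : (∑' i', if b j = b i' then p i' else 0) ≠ 0 := by
    intro h0
    have := ENNReal.tsum_eq_zero.1 h0 j
    simp [hp] at this
  have hfin := ne_top_of_le_ne_top ENNReal.one_ne_top hle
  have key' : ∀ k, b k = b j → ∀ a, (κ k).map φ a =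
      (∑' i, if b j = b i then p i * (κ i).map φ a else 0) /
        (∑' i', if b j = b i' then p i' else 0) := fun k hk a => by
    have := key k a
    rw [hk, mul_assoc, mul_comm (p k)] at this
    rw [ENNReal.eq_div_iff hne hfin, mul_comm]
    exact (ENNReal.mul_left_inj (hp k) (PMF.apply_ne_top _ _)).1 this
  ext a
  rw [key' i hij a, key' j rfl a]

theorem markovChain_of_map_eq {A : Ω → α} {B : Ω → β} {C : Ω → γ} {φ : T → α} {b : I → β}
    {c : I → γ} (hA : ∀ i t, A (o i t) = φ t) (hB : ∀ i t, B (o i t) = b i)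
    (hC : ∀ i t, C (o i t) = c i) (h : ∀ i j, b i = b j → (κ i).map φ = (κ j).map φ) :
    MarkovChain (p.bind fun i => (κ i).map (o i)) A B C := by
  classical
  intro a e e'
  have hBC : ∀ i t, (B (o i t), C (o i t)) = (b i, c i) := fun i t => by rw [hB, hC]
  rw [bind_map_apply_prod p κ o A (fun ω => (B ω, C ω)) hA hBC, bind_map_apply p κ o B hB,
    bind_map_apply_prod p κ o A B hA hB, bind_map_apply p κ o (fun ω => (B ω, C ω)) hBC]
  by_cases he : ∃ i, b i = e
  · obtain ⟨k, rfl⟩ := he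
    have e1 : ∀ i, (if (b k, e') = (b i, c i) then p i * (κ i).map φ a else 0) =
        (if (b k, e') = (b i, c i) then p i else 0) * (κ k).map φ a := fun i => by
      split_ifs with hi
      · rw [h i k (Prod.mk.inj hi).1.symm]
      · simp
    have e2 : ∀ i, (if b k = b i then p i * (κ i).map φ a else 0) =
        (if b k = b i then p i else 0) * (κ k).map φ a := fun i => by
      split_ifs with hi
      · rw [h i k hi.symm]
      · simp
    simp only [e1, e2, ENNReal.tsum_mul_right]
    ring
  · push Not at he
    have he' : ∀ i, ¬ e = b i := fun i hi => he i hi.symm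
    simp [he']

end Markov

/-! ### Consequences of correctness and privacy -/

namespace Protocol

variable {X Y Z : Type*} {P : Protocol X Y Z} {p : PMF (X × Y)} {F : X → Y → Z}

/-- If a mixture is a point mass, so is every component of positive weight. -/
theorem out_eq_pure {x : X} {y : Y} {z : Z}
    (h : ((P.transcripts x y).bind fun T => P.out T.M23 T.M31) = PMF.pure z) {T : Transcripts}
    (hT : P.transcripts x y T ≠ 0) : P.out T.M23 T.M31 = PMF.pure z := by
  have hs : ∀ z', P.out T.M23 T.M31 z' ≠ 0 → z' = z := fun z' hz => by
    rw [← PMF.mem_support_pure_iff, ← h, PMF.mem_support_bind_iff]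
    exact ⟨T, hT, hz⟩
  have h1 : P.out T.M23 T.M31 z = 1 := by
    rw [PMF.apply_eq_one_iff]
    refine Set.eq_singleton_iff_nonempty_unique_mem.2 ⟨PMF.support_nonempty _, hs⟩
  ext z'
  by_cases hz : z' = z
  · rw [hz, h1, PMF.pure_apply_self]
  · rw [PMF.pure_apply_of_ne _ _ hz]
    by_contra hne
    exact hz (hs z' hne)

/-- The output becomes a function of the inputs, which gives the law the form required by
`MarkovChain.map_eq`. -/
theorem law_eq (h : ∀ x y, p (x, y) ≠ 0 →
      ((P.transcripts x y).bind fun T => P.out T.M23 T.M31) = PMF.pure (F x y)) :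
    P.law p = p.bind fun xy => (P.transcripts xy.1 xy.2).map fun T =>
      ⟨xy.1, xy.2, T, F xy.1 xy.2⟩ := by
  ext o
  rw [law, PMF.bind_apply, PMF.bind_apply]
  refine tsum_congr fun xy => ?_
  by_cases hxy : p xy = 0
  · simp [hxy]
  congr 1
  rw [← PMF.bind_pure_comp, PMF.bind_apply, PMF.bind_apply]
  refine tsum_congr fun T => ?_
  by_cases hT : P.transcripts xy.1 xy.2 T = 0
  · simp [hT]
  congr 1
  rw [out_eq_pure (h _ _ hxy) hT, PMF.pure_map]
  rfl

namespace IsSecure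

variable (hP : P.IsSecure p fun x y => PMF.pure (F x y)) (hp : ∀ xy, p xy ≠ 0)

include hP hp

theorem map_alice_eq (x : X) (y y' : Y) :
    (P.transcripts x y).map (fun T => (T.M12, T.M31)) =
      (P.transcripts x y').map fun T => (T.M12, T.M31) := by
  have h := hP.privacy_alice
  rw [law_eq hP.correct] at h
  exact h.map_eq (i := (x, y)) (j := (x, y')) (b := Prod.fst) (c := fun xy => (xy.2, F xy.1 xy.2))
    (fun _ _ => rfl) (fun _ _ => rfl) (fun _ _ => rfl) hp
    (fun i j h h' => Prod.ext h (Prod.mk.inj h').1) rfl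

theorem map_bob_eq (x x' : X) (y : Y) :
    (P.transcripts x y).map (fun T => (T.M12, T.M23)) =
      (P.transcripts x' y).map fun T => (T.M12, T.M23) := by
  have h := hP.privacy_bob
  rw [law_eq hP.correct] at h
  exact h.map_eq (i := (x, y)) (j := (x', y)) (b := Prod.snd) (c := fun xy => (xy.1, F xy.1 xy.2))
    (fun _ _ => rfl) (fun _ _ => rfl) (fun _ _ => rfl) hp
    (fun i j h h' => Prod.ext (Prod.mk.inj h').1 h) rfl

theorem map_charlie_eq {x x' : X} {y y' : Y} (hF : F x y = F x' y') :
    (P.transcripts x y).map (fun T => (T.M23, T.M31)) =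
      (P.transcripts x' y').map fun T => (T.M23, T.M31) := by
  have h := hP.privacy_charlie
  rw [law_eq hP.correct] at h
  exact h.map_eq (i := (x, y)) (j := (x', y')) (b := fun xy => F xy.1 xy.2)
    (c := fun xy => (xy.1, xy.2))
    (fun _ _ => rfl) (fun _ _ => rfl) (fun _ _ => rfl) hp
    (fun i j _ h' => h') hF

theorem output_eq {x x' : X} {y y' : Y} {a : Transcript × Transcript}
    (h : (P.transcripts x y).map (fun T => (T.M23, T.M31)) a ≠ 0)
    (h' : (P.transcripts x' y').map (fun T => (T.M23, T.M31)) a ≠ 0) : F x y = F x' y' := by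
  rw [← PMF.mem_support_iff, PMF.mem_support_map_iff] at h h'
  obtain ⟨T, hT, rfl⟩ := h
  obtain ⟨T', hT', e⟩ := h'
  have h1 := out_eq_pure (hP.correct x y (hp _)) hT
  have h2 := out_eq_pure (hP.correct x' y' (hp _)) hT'
  rw [Prod.mk.injEq] at e
  rw [e.1, e.2, h1] at h2
  have := congrArg PMF.support h2
  simpa using this

/-- Privacy against Alice moves both executions to the same Bob input `y₀`. They agree on her links,
so by `transcripts_cut_alice` the transcripts `T` of the first are also possible for `x'`; Charlie's
output from `T` then has to be right for both inputs. -/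
theorem alice_input_eq {x x' : X} {y y' : Y} {a : Transcript × Transcript}
    (h : (P.transcripts x y).map (fun T => (T.M12, T.M31)) a ≠ 0)
    (h' : (P.transcripts x' y').map (fun T => (T.M12, T.M31)) a ≠ 0) (y₀ : Y) :
    F x y₀ = F x' y₀ := by
  rw [hP.map_alice_eq hp x y y₀, ← PMF.mem_support_iff, PMF.mem_support_map_iff] at h
  rw [hP.map_alice_eq hp x' y' y₀, ← PMF.mem_support_iff, PMF.mem_support_map_iff] at h'
  obtain ⟨T, hT, rfl⟩ := h
  obtain ⟨T', hT', e⟩ := h'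
  rw [Prod.mk.injEq] at e
  have hc := P.transcripts_cut_alice e.1.symm e.2.symm hT hT'
  refine hP.output_eq hp (a := (T.M23, T.M31)) ?_ ?_
  · exact (PMF.mem_support_map_iff _ _ _).2 ⟨T, hT, rfl⟩
  · exact (PMF.mem_support_map_iff _ _ _).2 ⟨T, hc, rfl⟩

theorem bob_input_eq {x x' : X} {y y' : Y} {a : Transcript × Transcript}
    (h : (P.transcripts x y).map (fun T => (T.M12, T.M23)) a ≠ 0)
    (h' : (P.transcripts x' y').map (fun T => (T.M12, T.M23)) a ≠ 0) (x₀ : X) :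
    F x₀ y = F x₀ y' := by
  rw [hP.map_bob_eq hp x x₀ y, ← PMF.mem_support_iff, PMF.mem_support_map_iff] at h
  rw [hP.map_bob_eq hp x' x₀ y', ← PMF.mem_support_iff, PMF.mem_support_map_iff] at h'
  obtain ⟨T, hT, rfl⟩ := h
  obtain ⟨T', hT', e⟩ := h'
  rw [Prod.mk.injEq] at e
  have hc := P.transcripts_cut_bob e.1.symm e.2.symm hT hT'
  refine hP.output_eq hp (a := (T.M23, T.M31)) ?_ ?_
  · exact (PMF.mem_support_map_iff _ _ _).2 ⟨T, hT, rfl⟩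
  · exact (PMF.mem_support_map_iff _ _ _).2 ⟨T, hc, rfl⟩

end IsSecure

end Protocol

/-! ### Combinatorics of the sum -/

section SumFun

variable {n : ℕ}

/-- Componentwise negation of a bit vector. -/
def flipBits (x : Fin n → Fin 2) : Fin n → Fin 2 := fun i => (x i).rev

theorem flipBits_flipBits (x : Fin n → Fin 2) : flipBits (flipBits x) = x := by
  funext i
  simp [flipBits]

theorem sumFun_comm (x y : Fin n → Fin 2) : sumFun n x y = sumFun n y x := by
  funext i
  simp [sumFun, add_comm]

theorem sumFun_flipBits (x : Fin n → Fin 2) : sumFun n x (flipBits x) = fun _ => 1 := by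
  have key : ∀ a : Fin 2, (a : ℕ) + (a.rev : ℕ) = 1 := by decide
  funext i
  exact Fin.ext (key (x i))

theorem sumFun_left_cancel {x y y' : Fin n → Fin 2} (h : sumFun n x y = sumFun n x y') :
    y = y' := by
  funext i
  have := congrArg Fin.val (congrFun h i)
  simp only [sumFun] at this
  exact Fin.ext (by omega)

theorem sumFun_right_cancel {x x' y : Fin n → Fin 2} (h : sumFun n x y = sumFun n x' y) :
    x = x' :=
  sumFun_left_cancel (x := y) (by rw [sumFun_comm, h, sumFun_comm])

theorem exists_sumFun_eq (z : Fin n → Fin 3) : ∃ xy : (Fin n → Fin 2) × (Fin n → Fin 2),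
    sumFun n xy.1 xy.2 = z := by
  have key : ∀ a : Fin 3, ∃ b c : Fin 2, (b : ℕ) + (c : ℕ) = a := by decide
  choose b c h using key
  exact ⟨(fun i => b (z i), fun i => c (z i)), funext fun i => Fin.ext (h (z i))⟩

/-- The number of ones in a ternary vector. -/
def numOnes (z : Fin n → Fin 3) : ℕ := ∑ i, if z i = 1 then 1 else 0

theorem numOnes_le (z : Fin n → Fin 3) : numOnes z ≤ n := by
  refine (Finset.sum_le_sum (g := fun _ => 1) fun i _ => ?_).trans (by simp)
  split_ifs <;> simp

theorem numOnes_add_numOnes_flipBits (x y : Fin n → Fin 2) :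
    numOnes (sumFun n x y) + numOnes (sumFun n x (flipBits y)) = n := by
  have key : ∀ a b : Fin 2, ((if (⟨(a : ℕ) + (b : ℕ), by omega⟩ : Fin 3) = 1 then 1 else 0) +
      if (⟨(a : ℕ) + (b.rev : ℕ), by omega⟩ : Fin 3) = 1 then 1 else 0) = 1 := by decide
  rw [numOnes, numOnes, ← Finset.sum_add_distrib]
  exact (Finset.sum_congr rfl fun i _ => key (x i) (y i)).trans (by simp)

/-- Flipping `y` turns ones of the sum into non-ones and conversely, so a sum has n/2 ones on
average. -/
theorem two_mul_sum_numOnes : 2 * ∑ xy : (Fin n → Fin 2) × (Fin n → Fin 2),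
    numOnes (sumFun n xy.1 xy.2) = n * 4 ^ n := by
  have h : ∑ xy : (Fin n → Fin 2) × (Fin n → Fin 2), numOnes (sumFun n xy.1 (flipBits xy.2)) =
      ∑ xy : (Fin n → Fin 2) × (Fin n → Fin 2), numOnes (sumFun n xy.1 xy.2) :=
    Equiv.sum_comp ((Equiv.refl (Fin n → Fin 2)).prodCongr
      (Function.Involutive.toPerm flipBits flipBits_flipBits))
      fun xy => numOnes (sumFun n xy.1 xy.2)
  rw [two_mul]
  nth_rw 2 [← h]
  rw [← Finset.sum_add_distrib]
  simp only [numOnes_add_numOnes_flipBits]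
  simp [mul_comm, ← mul_pow]

/-- A coordinate of `x` is free where `z` is 1 and forced where `z` is 0 or 2; then `x` and `z`
determine `y`. -/
theorem card_sumFun_eq_le (z : Fin n → Fin 3) :
    (Finset.univ.filter fun xy : (Fin n → Fin 2) × (Fin n → Fin 2) =>
      sumFun n xy.1 xy.2 = z).card ≤ 2 ^ numOnes z := by
  let S : Fin 3 → Finset (Fin 2) := fun c => Finset.univ.filter fun a =>
    ∃ b : Fin 2, (a : ℕ) + (b : ℕ) = c
  have hS : ∀ c, (S c).card = 2 ^ (if c = 1 then 1 else 0) := by decide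
  have hcard : (Fintype.piFinset fun i => S (z i)).card = 2 ^ numOnes z := by
    rw [Fintype.card_piFinset, numOnes, ← Finset.prod_pow_eq_pow_sum]
    exact Finset.prod_congr rfl fun i _ => hS (z i)
  rw [← hcard]
  refine Finset.card_le_card_of_injOn Prod.fst ?_ ?_
  · rintro ⟨x, y⟩ h
    simp only [Finset.mem_coe, Finset.mem_filter, Finset.mem_univ, true_and] at h
    simp only [Finset.mem_coe, Fintype.mem_piFinset, S, Finset.mem_filter, Finset.mem_univ,
      true_and]
    exact fun i => ⟨y i, congrArg Fin.val (congrFun h i)⟩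
  · rintro ⟨x, y⟩ h ⟨x', y'⟩ h' (rfl : x = x')
    simp only [Finset.mem_coe, Finset.mem_filter, Finset.mem_univ, true_and] at h h'
    rw [sumFun_left_cancel (h.trans h'.symm)]

end SumFun

/-! ### The logarithmic inequality and the means of its four ratios -/

section Bounds

/-- Roles: `a`, `b`, `c` are the masses of M12, M23, M31, `f` that of all transcripts, `α`, `β`, `g`
those of the transcript pairs of Alice, Bob, Charlie, `N` is 2^n and `K` bounds the number of input
pairs with the given sum. The four ratios have product at least `N * N / K * a`, and log t ≤ t - 1
applies to each. They stand for three relative entropies and a conditional mutual information, so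
each has mean at most 1 and the `- 4` compensates them. -/
theorem log_le_of_mul_le {a b c f u v w β g α N K : ℝ} (ha : 0 < a) (hc : 0 < c)
    (hf : 0 < f) (hu : 0 < u) (hv : 0 < v) (hw : 0 < w) (hβ : 0 < β) (hg : 0 < g) (hα : 0 < α)
    (hN : 0 < N) (hK : 0 < K) (hβb : β ≤ b) (h : a * b * c * f ≤ N * N * (w * u * v)) :
    Real.log (N * N / K) ≤ -Real.log a +
      (N * u / β + N * N / K * v / g + N * w / α + α * g / (c * f)) - 4 := by
  have h1 := Real.log_le_sub_one_of_pos (x := N * u / β) (by positivity)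
  have h2 := Real.log_le_sub_one_of_pos (x := N * N / K * v / g) (by positivity)
  have h3 := Real.log_le_sub_one_of_pos (x := N * w / α) (by positivity)
  have h4 := Real.log_le_sub_one_of_pos (x := α * g / (c * f)) (by positivity)
  have hprod : N * u / β * (N * N / K * v / g) * (N * w / α) * (α * g / (c * f)) =
      N * N / K * (N * N * (w * u * v) / (β * c * f)) := by
    field_simp
  have hle : N * N / K * a ≤
      N * u / β * (N * N / K * v / g) * (N * w / α) * (α * g / (c * f)) := by
    rw [hprod]
    refine mul_le_mul_of_nonneg_left ?_ (by positivity)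
    rw [le_div_iff₀ (by positivity)]
    refine le_trans ?_ h
    calc a * (β * c * f) = β * (a * c * f) := by ring
      _ ≤ b * (a * c * f) := by gcongr
      _ = a * b * c * f := by ring
  have hlog := Real.log_le_log (by positivity) hle
  rw [Real.log_mul (by positivity) (by positivity), Real.log_mul (by positivity) (by positivity),
    Real.log_mul (by positivity) (by positivity), Real.log_mul (by positivity) (by positivity)]
    at hlog
  linarith

theorem mul_mul_div_le (k c u : ℝ≥0∞) : k * (c * u / k) ≤ if k = 0 then 0 else c * u := by
  split_ifs with h
  · simp [h]
  · exact ENNReal.mul_div_le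

/-- The law of `φ` cancels with the denominator on its support, so a value `a` collects `c i` only
from those `i` that can produce it. -/
theorem sum_tsum_ratio_le {ι T α : Type*} [Fintype ι] (κ : ι → PMF T) (φ : T → α)
    (u : α → ℝ≥0∞) (hu : ∑' a, u a ≤ 1) (c : ι → ℝ≥0∞) (C : ℝ≥0∞)
    (hc : ∀ a (S : Finset ι), (∀ i ∈ S, (κ i).map φ a ≠ 0) → ∑ i ∈ S, c i ≤ C) :
    ∑ i, ∑' m, κ i m * (c i * u (φ m) / (κ i).map φ (φ m)) ≤ C := by
  classical
  calc ∑ i, ∑' m, κ i m * (c i * u (φ m) / (κ i).map φ (φ m))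
      = ∑ i, ∑' a, (κ i).map φ a * (c i * u a / (κ i).map φ a) := by
        refine Finset.sum_congr rfl fun i _ => ?_
        exact (tsum_map_mul (κ i) φ fun a => c i * u a / (κ i).map φ a).symm
    _ ≤ ∑ i, ∑' a, if (κ i).map φ a = 0 then 0 else c i * u a :=
        Finset.sum_le_sum fun i _ => ENNReal.tsum_le_tsum fun a => mul_mul_div_le _ _ _
    _ = ∑' a, ∑ i, if (κ i).map φ a = 0 then 0 else c i * u a :=
        (Summable.tsum_finsetSum fun i _ => ENNReal.summable).symm
    _ ≤ ∑' a, C * u a := by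
        refine ENNReal.tsum_le_tsum fun a => ?_
        have : ∑ i, (if (κ i).map φ a = 0 then 0 else c i * u a) =
            (∑ i ∈ Finset.univ.filter fun i => (κ i).map φ a ≠ 0, c i) * u a := by
          rw [Finset.sum_mul, Finset.sum_filter]
          exact Finset.sum_congr rfl fun i _ => by split_ifs <;> simp_all
        rw [this]
        gcongr
        exact hc a _ (by simp)
    _ ≤ C := by
        rw [ENNReal.tsum_mul_left]
        exact (mul_le_mul_right hu C).trans (mul_one C).le

/-- The summand is the coupling of `A` and `G` that is conditionally independent given the common
component. -/
theorem tsum_cond_indep_le {α β γ : Type*} (A : PMF (α × γ)) (G : PMF (β × γ)) (μ : PMF γ)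
    (hA : A.map Prod.snd = μ) (hG : G.map Prod.snd = μ) :
    ∑' c, ∑' a, ∑' b, A (a, c) * G (b, c) / μ c ≤ 1 := by
  rw [← μ.tsum_coe]
  refine ENNReal.tsum_le_tsum fun c => ?_
  simp only [div_eq_mul_inv, ENNReal.tsum_mul_left, ENNReal.tsum_mul_right]
  rw [← map_snd_apply, ← map_snd_apply, hA, hG, mul_assoc]
  exact (mul_le_mul_right (ENNReal.mul_inv_le_one _) _).trans (mul_one _).le

theorem tsum_transcripts (f : Transcripts → ℝ≥0∞) :
    ∑' m, f m = ∑' c, ∑' a, ∑' b, f ⟨a, b, c⟩ := by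
  let e : Transcript × Transcript × Transcript ≃ Transcripts :=
    ⟨fun q => ⟨q.2.1, q.2.2, q.1⟩, fun m => (m.M31, m.M12, m.M23), fun _ => rfl, fun _ => rfl⟩
  rw [← e.tsum_eq, ENNReal.tsum_prod']
  refine tsum_congr fun c => ?_
  rw [ENNReal.tsum_prod']
  rfl

end Bounds

/-! ### Bounds on M31, M23 and the randomness -/

namespace Protocol.IsSecure

variable {n : ℕ} {p : PMF ((Fin n → Fin 2) × (Fin n → Fin 2))}
  {P : Protocol (Fin n → Fin 2) (Fin n → Fin 2) (Fin n → Fin 3)}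

section

variable (hP : P.IsSecure p (sumFunctionality n)) (hp : ∀ xy, p xy ≠ 0)

include hP hp

theorem map_M12_eq (x x' y y' : Fin n → Fin 2) :
    (P.transcripts x y).map Transcripts.M12 = (P.transcripts x' y').map Transcripts.M12 := by
  have h1 := congrArg (PMF.map Prod.fst) (hP.map_alice_eq hp x y y')
  have h2 := congrArg (PMF.map Prod.fst) (hP.map_bob_eq hp x x' y')
  simp only [PMF.map_comp] at h1 h2
  exact h1.trans h2

/-- Alice's privacy allows changing `y` and Charlie's allows changing both inputs with fixed sum.
Every `x` has a complement giving the all-ones sum, and these pairs connect all inputs. -/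
theorem map_M31_eq (x x' y y' : Fin n → Fin 2) :
    (P.transcripts x y).map Transcripts.M31 = (P.transcripts x' y').map Transcripts.M31 := by
  have h1 := congrArg (PMF.map Prod.snd) (hP.map_alice_eq hp x y (flipBits x))
  have h2 := congrArg (PMF.map Prod.snd) (hP.map_charlie_eq hp (x := x) (y := flipBits x)
    (x' := x') (y' := flipBits x') (by rw [sumFun_flipBits, sumFun_flipBits]))
  have h3 := congrArg (PMF.map Prod.snd) (hP.map_alice_eq hp x' (flipBits x') y')
  simp only [PMF.map_comp] at h1 h2 h3
  exact (h1.trans h2).trans h3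

theorem map_M23_eq (x x' y y' : Fin n → Fin 2) :
    (P.transcripts x y).map Transcripts.M23 = (P.transcripts x' y').map Transcripts.M23 := by
  have h1 := congrArg (PMF.map Prod.snd) (hP.map_bob_eq hp x (flipBits y) y)
  have h2 := congrArg (PMF.map Prod.fst) (hP.map_charlie_eq hp (x := flipBits y) (y := y)
    (x' := flipBits y') (y' := y')
    (by rw [sumFun_comm, sumFun_flipBits, sumFun_comm, sumFun_flipBits]))
  have h3 := congrArg (PMF.map Prod.snd) (hP.map_bob_eq hp (flipBits y') x' y')
  simp only [PMF.map_comp] at h1 h2 h3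
  exact (h1.trans h2).trans h3

theorem map_M31_mul_le (x y : Fin n → Fin 2) (c : Transcript) :
    (P.transcripts x y).map Transcripts.M31 c * (3 ^ n : ℕ) ≤ 1 := by
  choose xy hxy using exists_sumFun_eq (n := n)
  have h := card_mul_map_snd_le_one
    (fun z => (P.transcripts (xy z).1 (xy z).2).map fun T => (T.M23, T.M31))
    ((P.transcripts x y).map Transcripts.M23) ((P.transcripts x y).map Transcripts.M31)
    (fun z => by rw [PMF.map_comp]; exact hP.map_M23_eq hp _ _ _ _)
    (fun z => by rw [PMF.map_comp]; exact hP.map_M31_eq hp _ _ _ _)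
    (fun z z' a h h' => by rw [← hxy z, ← hxy z']; exact hP.output_eq hp h h') c
  simpa using h

theorem map_M23_mul_le (x y : Fin n → Fin 2) (c : Transcript) :
    (P.transcripts x y).map Transcripts.M23 c * (3 ^ n : ℕ) ≤ 1 := by
  choose xy hxy using exists_sumFun_eq (n := n)
  have h := card_mul_map_snd_le_one
    (fun z => ((P.transcripts (xy z).1 (xy z).2).map fun T => (T.M23, T.M31)).map Prod.swap)
    ((P.transcripts x y).map Transcripts.M31) ((P.transcripts x y).map Transcripts.M23)
    (fun z => by rw [PMF.map_comp, PMF.map_comp]; exact hP.map_M31_eq hp _ _ _ _)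
    (fun z => by rw [PMF.map_comp, PMF.map_comp]; exact hP.map_M23_eq hp _ _ _ _)
    (fun z z' a h h' => by
      rw [← PMF.mem_support_iff, PMF.mem_support_map_iff] at h h'
      obtain ⟨b, hb, rfl⟩ := h
      obtain ⟨b', hb', e⟩ := h'
      rw [Prod.swap_injective e] at hb'
      rw [← hxy z, ← hxy z']
      exact hP.output_eq hp hb hb') c
  simpa using h

omit hp in
theorem law_map {τ : Type*} (φ : Transcripts → τ) (ν : PMF τ)
    (h : ∀ x y, (P.transcripts x y).map φ = ν) : (P.law p).map (fun o => φ o.T) = ν := by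
  rw [law_eq (F := sumFun n) hP.correct, PMF.map_bind]
  simp only [PMF.map_comp]
  exact (congrArg p.bind (funext fun xy => h xy.1 xy.2)).trans (PMF.bind_const p ν)

theorem le_H31 : ENNReal.ofReal (n * Real.logb 2 3) ≤ P.H31 p := by
  have h := entropy_ge (P.law p) (fun o => o.T.M31) (N := 3 ^ n) (by positivity) fun a => by
    rw [hP.law_map Transcripts.M31 _ fun x y => hP.map_M31_eq hp x 0 y 0]
    exact hP.map_M31_mul_le hp 0 0 a
  rwa [Nat.cast_pow, Real.logb_pow] at h

theorem le_H23 : ENNReal.ofReal (n * Real.logb 2 3) ≤ P.H23 p := by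
  have h := entropy_ge (P.law p) (fun o => o.T.M23) (N := 3 ^ n) (by positivity) fun a => by
    rw [hP.law_map Transcripts.M23 _ fun x y => hP.map_M23_eq hp x 0 y 0]
    exact hP.map_M23_mul_le hp 0 0 a
  rwa [Nat.cast_pow, Real.logb_pow] at h

theorem le_randomness : ENNReal.ofReal (n * Real.logb 2 3) ≤ P.randomness p := by
  classical
  have h := condEntropy_ge (P.law p) (fun o => (viewAlice o, viewBob o, viewCharlie o))
    (fun o => (o.x, o.y)) (N := 3 ^ n) (by positivity) fun a b => by
      -- Of the views only M31 is kept; given the inputs, its masses are at most 3^-n.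
      have h1 := le_map_apply ((P.law p).map fun o =>
        ((viewAlice o, viewBob o, viewCharlie o), (o.x, o.y))) (fun q => (q.1.1.2.2, q.2)) (a, b)
      rw [PMF.map_comp] at h1
      refine (mul_le_mul_left h1 _).trans ?_
      rw [law_eq (F := sumFun n) hP.correct]
      have h2 := bind_map_apply_prod p (fun xy => P.transcripts xy.1 xy.2)
        (fun xy T => (⟨xy.1, xy.2, T, sumFun n xy.1 xy.2⟩ : Outcome _ _ _)) (fun o => o.T.M31)
        (fun o => (o.x, o.y)) (φ := Transcripts.M31) (b := id) (fun _ _ => rfl) (fun _ _ => rfl)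
        a.1.2.2 b
      have h3 := bind_map_apply p (fun xy => P.transcripts xy.1 xy.2)
        (fun xy T => (⟨xy.1, xy.2, T, sumFun n xy.1 xy.2⟩ : Outcome _ _ _))
        (fun o => (o.x, o.y)) (b := id) (fun _ _ => rfl) b
      refine (mul_le_mul_left h2.le _).trans (le_trans ?_ h3.ge)
      rw [← ENNReal.tsum_mul_right]
      refine ENNReal.tsum_le_tsum fun xy => ?_
      split_ifs
      · rw [mul_assoc]
        exact (mul_le_mul_right (hP.map_M31_mul_le hp _ _ _) _).trans (mul_one _).le
      · simp
  rwa [Nat.cast_pow, Real.logb_pow] at h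

end

end Protocol.IsSecure

/-- `log_le_of_mul_le` in bits and in `[0, ∞]`, with the constant 4 moved to the left to avoid a
truncated subtraction. -/
theorem ofReal_log_le_of_mul_le {a b c f u v w β g α N K : ℝ≥0∞} (ha : a ≠ 0) (hc : c ≠ 0)
    (hf : f ≠ 0) (hβ : β ≠ 0) (hg : g ≠ 0) (hα : α ≠ 0) (hN : N ≠ 0) (hK : K ≠ 0)
    (ha' : a ≠ ∞) (hb' : b ≠ ∞) (hc' : c ≠ ∞) (hf' : f ≠ ∞) (hu' : u ≠ ∞) (hv' : v ≠ ∞)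
    (hw' : w ≠ ∞) (hβ' : β ≠ ∞) (hg' : g ≠ ∞) (hα' : α ≠ ∞) (hN' : N ≠ ∞) (hK' : K ≠ ∞)
    (hβb : β ≤ b)
    (hneg : 0 ≤ Real.logb 2 (N * N / K).toReal) (h : a * b * c * f ≤ N * N * (w * u * v)) :
    ENNReal.ofReal (Real.logb 2 (N * N / K).toReal) + ENNReal.ofReal (Real.log 2)⁻¹ * 4 ≤
      ENNReal.ofReal (-Real.logb 2 a.toReal) + ENNReal.ofReal (Real.log 2)⁻¹ *
        (N * u / β + N * N / K * v / g + N * w / α + α * g / (c * f)) := by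
  have hb : b ≠ 0 := fun h0 => hβ (nonpos_iff_eq_zero.1 (hβb.trans_eq h0))
  have hl : 0 < Real.log 2 := Real.log_pos (by norm_num)
  have huvw : w * u * v ≠ 0 := by
    intro h0
    rw [h0, mul_zero, nonpos_iff_eq_zero] at h
    exact mul_ne_zero (mul_ne_zero (mul_ne_zero ha hb) hc) hf h
  have hv : v ≠ 0 := right_ne_zero_of_mul huvw
  have hu : u ≠ 0 := right_ne_zero_of_mul (left_ne_zero_of_mul huvw)
  have hw : w ≠ 0 := left_ne_zero_of_mul (left_ne_zero_of_mul huvw)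
  have hreal := log_le_of_mul_le (ENNReal.toReal_pos ha ha') (ENNReal.toReal_pos hc hc')
    (ENNReal.toReal_pos hf hf') (ENNReal.toReal_pos hu hu') (ENNReal.toReal_pos hv hv')
    (ENNReal.toReal_pos hw hw') (ENNReal.toReal_pos hβ hβ') (ENNReal.toReal_pos hg hg')
    (ENNReal.toReal_pos hα hα') (ENNReal.toReal_pos hN hN') (ENNReal.toReal_pos hK hK')
    (ENNReal.toReal_mono hb' hβb) (by
      simpa only [ENNReal.toReal_mul] using
        ENNReal.toReal_mono (by finiteness) h)
  have f1 : N * u / β ≠ ∞ := ENNReal.div_ne_top (ENNReal.mul_ne_top hN' hu') hβ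
  have f2 : N * N / K * v / g ≠ ∞ := ENNReal.div_ne_top (ENNReal.mul_ne_top
    (ENNReal.div_ne_top (ENNReal.mul_ne_top hN' hN') hK) hv') hg
  have f3 : N * w / α ≠ ∞ := ENNReal.div_ne_top (ENNReal.mul_ne_top hN' hw') hα
  have f4 : α * g / (c * f) ≠ ∞ :=
    ENNReal.div_ne_top (ENNReal.mul_ne_top hα' hg') (mul_ne_zero hc hf)
  have hsum : N * u / β + N * N / K * v / g + N * w / α + α * g / (c * f) =
      ENNReal.ofReal (N.toReal * u.toReal / β.toReal +
        N.toReal * N.toReal / K.toReal * v.toReal / g.toReal + N.toReal * w.toReal / α.toReal +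
        α.toReal * g.toReal / (c.toReal * f.toReal)) := by
    rw [← ENNReal.ofReal_toReal (by finiteness :
      N * u / β + N * N / K * v / g + N * w / α + α * g / (c * f) ≠ ∞)]
    rw [ENNReal.toReal_add (by finiteness) f4, ENNReal.toReal_add (by finiteness) f3,
      ENNReal.toReal_add f1 f2]
    simp only [ENNReal.toReal_mul, ENNReal.toReal_div]
  rw [hsum, ← ENNReal.ofReal_mul (by positivity), show (4 : ℝ≥0∞) = ENNReal.ofReal 4 by simp,
    ← ENNReal.ofReal_mul (by positivity)]
  rw [← ENNReal.ofReal_add hneg (by positivity)]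
  refine le_trans (ENNReal.ofReal_le_ofReal ?_) ENNReal.ofReal_add_le
  simp only [Real.logb, ENNReal.toReal_mul, ENNReal.toReal_div]
  have := mul_le_mul_of_nonneg_left hreal (inv_nonneg.2 hl.le)
  have e : ∀ x : ℝ, x / Real.log 2 = (Real.log 2)⁻¹ * x := fun x => div_eq_inv_mul _ _
  rw [e, e]
  linarith

theorem mixture_const {X Y α : Type*} (qX : PMF X) (qY : PMF Y) (ν : PMF α) :
    mixture qX qY (fun _ _ => ν) = ν := by
  simp [mixture, PMF.bind_const]

theorem logb_weight (n k : ℕ) :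
    Real.logb 2 ((2 ^ n * 2 ^ n / 2 ^ k : ℝ≥0∞)).toReal = 2 * n - k := by
  simp only [ENNReal.toReal_div, ENNReal.toReal_mul, ENNReal.toReal_pow, ENNReal.toReal_ofNat]
  rw [Real.logb_div (by positivity) (by positivity), Real.logb_mul (by positivity) (by positivity),
    Real.logb_pow, Real.logb_pow, Real.logb_self_eq_one (by norm_num)]
  ring

/-- The average of 2n minus the number of ones is 2n - n/2, the entropy of the sum of uniform
inputs. -/
theorem sum_weights (n : ℕ) : ∑ xy : (Fin n → Fin 2) × (Fin n → Fin 2),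
    ENNReal.ofReal (2 * n - numOnes (sumFun n xy.1 xy.2)) = 4 ^ n * ENNReal.ofReal (1.5 * n) := by
  rw [← ENNReal.ofReal_sum_of_nonneg]
  · rw [show (4 : ℝ≥0∞) ^ n = ENNReal.ofReal (4 ^ n) by
      rw [ENNReal.ofReal_pow (by norm_num)]; simp, ← ENNReal.ofReal_mul (by positivity)]
    congr 1
    rw [Finset.sum_sub_distrib]
    have h : (2 : ℝ) * ∑ xy : (Fin n → Fin 2) × (Fin n → Fin 2),
        (numOnes (sumFun n xy.1 xy.2) : ℝ) = n * 4 ^ n := by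
      exact_mod_cast two_mul_sum_numOnes (n := n)
    have hc : ((Finset.univ : Finset ((Fin n → Fin 2) × (Fin n → Fin 2))).card : ℝ) = 4 ^ n := by
      simp [← mul_pow]
    rw [Finset.sum_const, nsmul_eq_mul, hc]
    linarith
  · intro xy _
    have : (numOnes (sumFun n xy.1 xy.2) : ℝ) ≤ n := by exact_mod_cast numOnes_le _
    linarith [(Nat.cast_nonneg n : (0 : ℝ) ≤ n)]

/-! ### The bound on M12 -/

namespace Protocol.IsSecure

variable {n : ℕ} {p : PMF ((Fin n → Fin 2) × (Fin n → Fin 2))}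
  {P : Protocol (Fin n → Fin 2) (Fin n → Fin 2) (Fin n → Fin 3)}

/-- The uniform mixture of inputs has the same link marginals as any fixed input pair, and 4^n times
the mixture dominates the law for that pair. -/
theorem exists_weights_M12 (hP : P.IsSecure p (sumFunctionality n)) (hp : ∀ xy, p xy ≠ 0) :
    ∃ w u v : Transcript × Transcript → ℝ≥0∞,
    ∑' a, w a ≤ 1 ∧ ∑' a, u a ≤ 1 ∧ ∑' a, v a ≤ 1 ∧ ∀ x y m,
      (P.transcripts x y).map Transcripts.M12 m.M12 *
        (P.transcripts x y).map Transcripts.M23 m.M23 *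
        (P.transcripts x y).map Transcripts.M31 m.M31 * P.transcripts x y m ≤
      2 ^ n * 2 ^ n * (w (m.M12, m.M31) * u (m.M12, m.M23) * v (m.M23, m.M31)) := by
  let q := PMF.uniformOfFintype (Fin n → Fin 2)
  obtain ⟨w, u, v, hw, hu, hv, h⟩ := P.exists_transcripts_weights q q
  refine ⟨w, u, v, hw, hu, hv, fun x y m => ?_⟩
  have e12 : (mixture q q P.transcripts).map Transcripts.M12 =
      (P.transcripts x y).map Transcripts.M12 := by
    rw [mixture_map]
    simp only [hP.map_M12_eq hp _ x _ y, mixture_const]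
  have e23 : (mixture q q P.transcripts).map Transcripts.M23 =
      (P.transcripts x y).map Transcripts.M23 := by
    rw [mixture_map]
    simp only [hP.map_M23_eq hp _ x _ y, mixture_const]
  have e31 : (mixture q q P.transcripts).map Transcripts.M31 =
      (P.transcripts x y).map Transcripts.M31 := by
    rw [mixture_map]
    simp only [hP.map_M31_eq hp _ x _ y, mixture_const]
  have hJ : P.transcripts x y m ≤ 2 ^ n * 2 ^ n * mixture q q P.transcripts m := by
    have h1 : q x * q y * P.transcripts x y m ≤ mixture q q P.transcripts m := by
      rw [mixture_apply]
      exact (ENNReal.le_tsum (f := fun y => q x * q y * P.transcripts x y m) y).trans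
        (ENNReal.le_tsum (f := fun x => ∑' y, q x * q y * P.transcripts x y m) x)
    have hq : ∀ x, (2 : ℝ≥0∞) ^ n * q x = 1 := fun x => by
      simp only [q, PMF.uniformOfFintype_apply, Fintype.card_fun, Fintype.card_fin, Nat.cast_pow,
        Nat.cast_ofNat]
      exact ENNReal.mul_inv_cancel (by positivity) (by finiteness)
    calc P.transcripts x y m = (2 ^ n * q x) * (2 ^ n * q y) * P.transcripts x y m := by
          rw [hq, hq, one_mul, one_mul]
      _ = 2 ^ n * 2 ^ n * (q x * q y * P.transcripts x y m) := by ring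
      _ ≤ _ := by gcongr
  have hm := h m
  rw [e12, e23, e31] at hm
  refine (mul_le_mul_right hJ _).trans (le_trans (le_of_eq ?_) (mul_le_mul_right hm _))
  ring

theorem le_H12 (hP : P.IsSecure p (sumFunctionality n)) (hp : ∀ xy, p xy ≠ 0) :
    ENNReal.ofReal (1.5 * n) ≤ P.H12 p := by
  classical
  obtain ⟨w, u, v, hw, hu, hv, hle⟩ := hP.exists_weights_M12 hp
  have ft : ∀ {f : Transcript × Transcript → ℝ≥0∞} (_ : ∑' a, f a ≤ 1) a, f a ≠ ∞ :=
    fun h a => ne_top_of_le_ne_top ENNReal.one_ne_top ((ENNReal.le_tsum a).trans h)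
  let N : ℝ≥0∞ := 2 ^ n
  let c : ℝ≥0∞ := ENNReal.ofReal (Real.log 2)⁻¹
  have hNN : N * N = 4 ^ n := by
    simp only [N]
    rw [← mul_pow]
    norm_num
  let κ : (Fin n → Fin 2) × (Fin n → Fin 2) → PMF Transcripts := fun i => P.transcripts i.1 i.2
  let φA : Transcripts → Transcript × Transcript := fun T => (T.M12, T.M31)
  let φB : Transcripts → Transcript × Transcript := fun T => (T.M12, T.M23)
  let φC : Transcripts → Transcript × Transcript := fun T => (T.M23, T.M31)
  let K : (Fin n → Fin 2) × (Fin n → Fin 2) → ℝ≥0∞ := fun i => 2 ^ numOnes (sumFun n i.1 i.2)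
  let R₁ : (Fin n → Fin 2) × (Fin n → Fin 2) → Transcripts → ℝ≥0∞ := fun i m =>
    N * u (φB m) / (κ i).map φB (φB m)
  let R₂ : (Fin n → Fin 2) × (Fin n → Fin 2) → Transcripts → ℝ≥0∞ := fun i m =>
    N * N / K i * v (φC m) / (κ i).map φC (φC m)
  let R₃ : (Fin n → Fin 2) × (Fin n → Fin 2) → Transcripts → ℝ≥0∞ := fun i m =>
    N * w (φA m) / (κ i).map φA (φA m)
  let R₄ : (Fin n → Fin 2) × (Fin n → Fin 2) → Transcripts → ℝ≥0∞ := fun i m =>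
    (κ i).map φA (φA m) * (κ i).map φC (φC m) / ((κ i).map Transcripts.M31 m.M31 * κ i m)
  have hpow : ∀ k : ℕ, (2 : ℝ≥0∞) ^ k ≠ 0 := fun k => by positivity
  have hpow' : ∀ k : ℕ, (2 : ℝ≥0∞) ^ k ≠ ∞ := fun k => by finiteness
  have hpoint : ∀ i m, κ i m * (ENNReal.ofReal (2 * n - numOnes (sumFun n i.1 i.2)) + c * 4) ≤
      κ i m * ENNReal.ofReal (-Real.logb 2 ((κ i).map Transcripts.M12 m.M12).toReal) +
      c * (κ i m * R₁ i m + κ i m * R₂ i m + κ i m * R₃ i m + κ i m * R₄ i m) := by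
    intro i m
    by_cases hm : κ i m = 0
    · simp [hm]
    have pos : ∀ {τ : Type} (φ : Transcripts → τ), (κ i).map φ (φ m) ≠ 0 := fun φ h0 =>
      hm (nonpos_iff_eq_zero.1 ((le_map_apply (κ i) φ m).trans_eq h0))
    have h := ofReal_log_le_of_mul_le (pos Transcripts.M12) (pos Transcripts.M31) hm (pos φB)
      (pos φC) (pos φA) (hpow n) (hpow (numOnes (sumFun n i.1 i.2)))
      (PMF.apply_ne_top _ _) (PMF.apply_ne_top ((κ i).map Transcripts.M23) m.M23)
      (PMF.apply_ne_top _ _) (PMF.apply_ne_top _ _) (ft hu (φB m)) (ft hv (φC m)) (ft hw (φA m))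
      (PMF.apply_ne_top _ _) (PMF.apply_ne_top _ _) (PMF.apply_ne_top _ _) (hpow' n) (hpow' _)
      (by
        have := le_map_apply ((κ i).map φB) Prod.snd (φB m)
        rwa [PMF.map_comp] at this)
      (by
        rw [logb_weight]
        have : (numOnes (sumFun n i.1 i.2) : ℝ) ≤ n := by exact_mod_cast numOnes_le _
        linarith [(Nat.cast_nonneg n : (0 : ℝ) ≤ n)])
      (hle i.1 i.2 m)
    rw [logb_weight] at h
    refine (mul_le_mul_right h (κ i m)).trans (le_of_eq ?_)
    simp only [R₁, R₂, R₃, R₄, N, K, c]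
    ring
  have hH : ∀ i, ∑' m, κ i m *
      ENNReal.ofReal (-Real.logb 2 ((κ i).map Transcripts.M12 m.M12).toReal) = P.H12 p := by
    intro i
    rw [← tsum_map_mul (κ i) Transcripts.M12
      fun a => ENNReal.ofReal (-Real.logb 2 ((κ i).map Transcripts.M12 a).toReal), H12, entropy,
      hP.law_map Transcripts.M12 _ fun x y => hP.map_M12_eq hp x i.1 y i.2]
    refine tsum_congr fun a => ?_
    rw [← mul_neg, ENNReal.ofReal_mul ENNReal.toReal_nonneg,
      ENNReal.ofReal_toReal (PMF.apply_ne_top _ _)]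
  have h1 : ∑ i, ∑' m, κ i m * R₁ i m ≤ 4 ^ n := by
    refine sum_tsum_ratio_le κ φB u hu (fun _ => N) _ fun a S hS => ?_
    rw [Finset.sum_const, nsmul_eq_mul, ← hNN]
    gcongr
    -- Bob's transcripts determine `y`, so the input pairs that can produce `a` are distinguished by
    -- `x`.
    have hcard : S.card ≤ (Finset.univ : Finset (Fin n → Fin 2)).card := by
      refine Finset.card_le_card_of_injOn Prod.fst (fun _ _ => Finset.mem_coe.2
        (Finset.mem_univ _)) fun i hi j hj hij => Prod.ext hij ?_
      exact sumFun_left_cancel (hP.bob_input_eq hp (hS i hi) (hS j hj) 0)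
    simpa [N] using (Nat.cast_le (α := ℝ≥0∞)).2 hcard
  have h3 : ∑ i, ∑' m, κ i m * R₃ i m ≤ 4 ^ n := by
    refine sum_tsum_ratio_le κ φA w hw (fun _ => N) _ fun a S hS => ?_
    rw [Finset.sum_const, nsmul_eq_mul, ← hNN]
    gcongr
    have hcard : S.card ≤ (Finset.univ : Finset (Fin n → Fin 2)).card := by
      refine Finset.card_le_card_of_injOn Prod.snd (fun _ _ => Finset.mem_coe.2
        (Finset.mem_univ _)) fun i hi j hj hij => Prod.ext ?_ hij
      exact sumFun_right_cancel (hP.alice_input_eq hp (hS i hi) (hS j hj) 0)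
    simpa [N] using (Nat.cast_le (α := ℝ≥0∞)).2 hcard
  have h2 : ∑ i, ∑' m, κ i m * R₂ i m ≤ 4 ^ n := by
    refine sum_tsum_ratio_le κ φC v hv (fun i => N * N / K i) _ fun a S hS => ?_
    obtain rfl | ⟨j, hj⟩ := S.eq_empty_or_nonempty
    · simp
    -- Charlie's transcripts determine the sum, so `S` lies in one fibre and its size cancels
    -- against `K`.
    have heq : ∀ i ∈ S, sumFun n i.1 i.2 = sumFun n j.1 j.2 := fun i hi =>
      hP.output_eq hp (hS i hi) (hS j hj)
    have hcard : S.card ≤ 2 ^ numOnes (sumFun n j.1 j.2) :=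
      (Finset.card_le_card fun i hi => Finset.mem_filter.2 ⟨Finset.mem_univ i, heq i hi⟩).trans
        (card_sumFun_eq_le _)
    have hcard' : (S.card : ℝ≥0∞) ≤ K j := by
      simpa [K] using (Nat.cast_le (α := ℝ≥0∞)).2 hcard
    calc ∑ i ∈ S, N * N / K i = S.card * (N * N / K j) := by
          rw [Finset.sum_congr rfl (g := fun _ => N * N / K j) fun i hi => by simp only [K, heq i hi],
            Finset.sum_const, nsmul_eq_mul]
      _ ≤ K j * (N * N / K j) := by gcongr
      _ ≤ N * N := ENNReal.mul_div_le
      _ = 4 ^ n := hNN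
  have hcard : ((Finset.univ : Finset ((Fin n → Fin 2) × (Fin n → Fin 2))).card : ℝ≥0∞) =
      4 ^ n := by
    rw [← hNN]
    simp [N]
  have h4 : ∑ i, ∑' m, κ i m * R₄ i m ≤ 4 ^ n := by
    refine (Finset.sum_le_sum (g := fun _ => 1) fun i _ => ?_).trans (by simp [← hcard])
    refine le_trans (ENNReal.tsum_le_tsum fun m => ?_) (tsum_cond_indep_le ((κ i).map φA)
      ((κ i).map φC) ((κ i).map Transcripts.M31) (by rw [PMF.map_comp]; rfl)
      (by rw [PMF.map_comp]; rfl) |> (tsum_transcripts fun m => (κ i).map φA (φA m) *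
        (κ i).map φC (φC m) / (κ i).map Transcripts.M31 m.M31).trans_le)
    simp only [R₄]
    by_cases hm : κ i m = 0
    · simp [hm]
    · rw [← mul_div_assoc, mul_comm (κ i m), ENNReal.mul_div_mul_right _ _ hm
        (PMF.apply_ne_top _ _)]
  have hsum : ∀ i, ENNReal.ofReal (2 * n - numOnes (sumFun n i.1 i.2)) + c * 4 ≤ P.H12 p +
      c * (∑' m, κ i m * R₁ i m + ∑' m, κ i m * R₂ i m + ∑' m, κ i m * R₃ i m +
        ∑' m, κ i m * R₄ i m) := by
    intro i
    have h := ENNReal.tsum_le_tsum (hpoint i)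
    rw [tsum_mul_const, ENNReal.tsum_add, hH, ENNReal.tsum_mul_left] at h
    simpa only [ENNReal.tsum_add] using h
  have htot := Finset.sum_le_sum fun i (_ : i ∈ Finset.univ) => hsum i
  rw [Finset.sum_add_distrib, Finset.sum_add_distrib, sum_weights, Finset.sum_const,
    Finset.sum_const, nsmul_eq_mul, nsmul_eq_mul, hcard, ← Finset.mul_sum] at htot
  simp only [Finset.sum_add_distrib] at htot
  have hfin : (4 : ℝ≥0∞) ^ n * (c * 4) ≠ ∞ :=
    ENNReal.mul_ne_top (by finiteness) (ENNReal.mul_ne_top ENNReal.ofReal_ne_top (by simp))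
  have hbound := htot.trans (add_le_add_right (mul_le_mul_right
    (add_le_add (add_le_add (add_le_add h1 h2) h3) h4) c) _)
  have hc4 : c * (4 ^ n + 4 ^ n + 4 ^ n + 4 ^ n) = 4 ^ n * (c * 4) := by ring
  -- The four means contribute exactly the constant on the left. It is finite and cancels even if
  -- the entropy is infinite.
  rw [hc4, ENNReal.add_le_add_iff_right hfin] at hbound
  exact (ENNReal.mul_le_mul_iff_right (by positivity) (by finiteness)).1 hbound

end Protocol.IsSecure

/-! ### The ternary code -/

section Encode

theorem prefixFree_range_encodeTrit : PrefixFree (Set.range encodeTrit) := by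
  have key : ∀ a b : Fin 3, encodeTrit a <+: encodeTrit b → encodeTrit a = encodeTrit b := by
    decide
  rintro _ ⟨a, rfl⟩ _ ⟨b, rfl⟩ h
  exact key a b h

theorem encodeTrit_injective : Function.Injective encodeTrit := by
  have key : ∀ a b : Fin 3, encodeTrit a = encodeTrit b → a = b := by decide
  exact fun a b => key a b

theorem encode_succ {n : ℕ} (v : Fin (n + 1) → Fin 3) :
    encode v = encodeTrit (v 0) ++ encode (Fin.tail v) := by
  simp [encode, List.ofFn_succ, Fin.tail]

theorem eq_of_encode_prefix {n : ℕ} {u v : Fin n → Fin 3} (h : encode u <+: encode v) :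
    u = v := by
  induction n with
  | zero => exact Subsingleton.elim _ _
  | succ n ih =>
    rw [encode_succ, encode_succ] at h
    obtain ⟨s, hs⟩ := h
    rw [List.append_assoc] at hs
    have h0 := prefixFree_range_encodeTrit.append_inj ⟨u 0, rfl⟩ ⟨v 0, rfl⟩ hs
    rw [h0] at hs
    have ht := ih ⟨s, List.append_cancel_left hs⟩
    rw [← Fin.cons_self_tail u, ← Fin.cons_self_tail v, encodeTrit_injective h0, ht]

theorem encode_injective (n : ℕ) : Function.Injective (encode (n := n)) :=
  fun _ _ h => eq_of_encode_prefix (h ▸ List.prefix_rfl)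

theorem decode_encode {n : ℕ} (v : Fin n → Fin 3) : decode n (encode v) = v :=
  Function.leftInverse_invFun (encode_injective n) v

theorem prefixFree_range_encode (n : ℕ) : PrefixFree (Set.range (encode (n := n))) := by
  rintro _ ⟨u, rfl⟩ _ ⟨v, rfl⟩ h
  rw [eq_of_encode_prefix h]

theorem prefixFree_singleton (m : Msg) : PrefixFree {m} := by
  rintro _ rfl _ rfl _
  rfl

theorem toTrits_add_toTrits {n : ℕ} (x y : Fin n → Fin 2) :
    toTrits x + toTrits y = sumFun n x y := by
  have key : ∀ a b : Fin 2, a.castSucc + b.castSucc = (⟨(a : ℕ) + (b : ℕ), by omega⟩ : Fin 3) := by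
    decide
  exact funext fun i => key (x i) (y i)

end Encode

section Uniform

theorem map_uniformOfFintype_equiv {α : Type*} [Fintype α] [Nonempty α] (e : α ≃ α) :
    (PMF.uniformOfFintype α).map e = PMF.uniformOfFintype α := by
  classical
  ext a
  rw [PMF.map_apply, tsum_eq_single (e.symm a)]
  · simp
  · intro b hb
    rw [if_neg]
    rintro rfl
    simp at hb

theorem pmf_eq_of_le {α : Type*} {f g : PMF α} (h : ∀ a, f a ≤ g a) : f = g := by
  ext a
  by_contra hne
  have := ENNReal.tsum_lt_tsum f.tsum_coe_ne_top h (lt_of_le_of_ne (h a) hne)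
  simp at this

end Uniform

/-! ### Security and randomness of the mod-3 protocol -/

namespace Mod3

variable {n : ℕ} (x y : Fin n → Fin 2) (K : Fin n → Fin 3)

/-- The first round of the mod-3 protocol. -/
def round1 : Round := ⟨[], [], [], [], encode K, []⟩

/-- The second round of the mod-3 protocol. -/
def round2 : Round := ⟨encode (K + toTrits x), [], [], [], [], []⟩

/-- The third round of the mod-3 protocol. -/
def round3 : Round := ⟨[], [], encode (K + toTrits x + toTrits y), [], [], []⟩

/-- The transcripts of the mod-3 protocol when Charlie chooses `K`. -/
def finalTranscripts : Transcripts :=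
  ⟨(encode (K + toTrits x), []), (encode (K + toTrits x + toTrits y), []), (encode K, [])⟩

theorem step_nil : (mod3Protocol n).step x y [] =
    (PMF.uniformOfFintype (Fin n → Fin 3)).map round1 := by
  simp [NextMessage.step, mod3Protocol, link12, link23, link31, PMF.map_comp, Function.comp_def]
  rfl

theorem step_round1 : (mod3Protocol n).step x y [round1 K] = PMF.pure (round2 x K) := by
  simp [NextMessage.step, mod3Protocol, link12, link23, link31, LinkHistory.transcript, round1,
    round2, PMF.pure_map, decode_encode]

theorem step_round2 :
    (mod3Protocol n).step x y [round1 K, round2 x K] = PMF.pure (round3 x y K) := by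
  simp [NextMessage.step, mod3Protocol, link12, link23, link31, LinkHistory.transcript, round1,
    round2, round3, PMF.pure_map, decode_encode]

theorem step_of_length {h : History} (hh : 3 ≤ h.length) :
    (mod3Protocol n).step x y h = PMF.pure emptyRound := by
  have h0 : h ≠ [] := by
    rintro rfl
    simp at hh
  have h1 : h.length ≠ 1 := by omega
  have h2 : h.length ≠ 2 := by omega
  simp [NextMessage.step, mod3Protocol, link12, link23, link31, h0, h1, h2, PMF.pure_map,
    emptyRound]

theorem terminated {h : History} (hh : 3 ≤ h.length) : (mod3Protocol n).Terminated x y h :=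
  fun k => step_of_length x y (by simp; omega)

theorem run_three : (mod3Protocol n).run x y 3 = (PMF.uniformOfFintype (Fin n → Fin 3)).map
    fun K => [round1 K, round2 x K, round3 x y K] := by
  simp only [NextMessage.run, PMF.pure_bind, step_nil, PMF.map_comp, PMF.bind_map]
  simp only [Function.comp_def, List.nil_append, step_round1, PMF.pure_map, PMF.bind_bind,
    PMF.pure_bind, List.cons_append, step_round2]
  exact PMF.bind_pure_comp _ _

theorem transcriptsOf_rounds :
    transcriptsOf [round1 K, round2 x K, round3 x y K] = finalTranscripts x y K := by
  simp [transcriptsOf, link12, link23, link31, LinkHistory.transcript, round1, round2, round3,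
    finalTranscripts]

theorem prefixFreeMessages (n : ℕ) : (mod3Protocol n).PrefixFreeMessages := by
  classical
  -- The length of a link history is the round number, so the code can be the ternary one in the
  -- single scheduled round and trivial otherwise.
  let c : ℕ → LinkHistory → Set Msg := fun k l =>
    if l.length = k then Set.range (encode (n := n)) else {[]}
  have hc : ∀ k l, PrefixFree (c k l) := fun k l => by
    simp only [c]
    split_ifs
    · exact prefixFree_range_encode n
    · exact prefixFree_singleton _
  refine ⟨c 1, fun _ => {[]}, c 2, fun _ => {[]}, c 0, fun _ => {[]}, fun l =>
    ⟨hc _ l, prefixFree_singleton _, hc _ l, prefixFree_singleton _, hc _ l,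
      prefixFree_singleton _⟩, fun x y t h _ r hr => ?_⟩
  rw [PMF.mem_support_iff, NextMessage.step_apply] at hr
  have hA := (PMF.mem_support_iff _ _).2 (left_ne_zero_of_mul (left_ne_zero_of_mul hr))
  have hB := (PMF.mem_support_iff _ _).2 (right_ne_zero_of_mul (left_ne_zero_of_mul hr))
  have hC := (PMF.mem_support_iff _ _).2 (right_ne_zero_of_mul hr)
  simp only [mod3Protocol, length_link12, length_link23, length_link31] at hA hB hC
  have hA' : r.m12 ∈ c 1 (link12 h) ∧ r.m13 = [] := by
    simp only [c, length_link12]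
    split_ifs at hA ⊢
    · rw [PMF.mem_support_pure_iff, Prod.mk.injEq] at hA
      exact ⟨⟨_, hA.1.symm⟩, hA.2⟩
    · rwa [PMF.mem_support_pure_iff, Prod.mk.injEq] at hA
  have hB' : r.m21 = [] ∧ r.m23 ∈ c 2 (link23 h) := by
    simp only [c, length_link23]
    split_ifs at hB ⊢
    · rw [PMF.mem_support_pure_iff, Prod.mk.injEq] at hB
      exact ⟨hB.1, ⟨_, hB.2.symm⟩⟩
    · rwa [PMF.mem_support_pure_iff, Prod.mk.injEq] at hB
  have hC' : r.m31 ∈ c 0 (link31 h) ∧ r.m32 = [] := by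
    simp only [c, length_link31]
    split_ifs at hC ⊢
    · rw [PMF.mem_support_map_iff] at hC
      obtain ⟨K, _, e⟩ := hC
      rw [Prod.mk.injEq] at e
      exact ⟨⟨K, e.1⟩, e.2.symm⟩
    · rwa [PMF.mem_support_pure_iff, Prod.mk.injEq] at hC
  exact ⟨hA'.1, hB'.1, hB'.2, hC'.2, hC'.1, hA'.2⟩

theorem terminates : ⨆ t, (mod3Protocol n).terminatedProb x y t = 1 := by
  refine le_antisymm (iSup_le fun t => ?_) (le_iSup_of_le 3 ?_)
  · rw [NextMessage.terminatedProb, PMF.toOuterMeasure_apply]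
    exact (ENNReal.tsum_le_tsum fun h => Set.indicator_le_self _ _ _).trans (PMF.tsum_coe _).le
  · refine ge_of_eq ((PMF.toOuterMeasure_apply_eq_one_iff _ _).2 fun h hh => ?_)
    exact terminated x y (NextMessage.length_of_run_ne_zero hh).ge

/-- The mod-3 protocol as a well-formed protocol. -/
def protocol (n : ℕ) : Protocol (Fin n → Fin 2) (Fin n → Fin 2) (Fin n → Fin 3) where
  toNextMessage := mod3Protocol n
  prefixFree := prefixFreeMessages n
  terminates := terminates

theorem transcripts_eq : (protocol n).transcripts x y =
    (PMF.uniformOfFintype (Fin n → Fin 3)).map (finalTranscripts x y) := by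
  symm
  -- Both sides have total mass 1, so one inequality suffices; the mass already terminated after
  -- three rounds provides it.
  refine pmf_eq_of_le fun m => ?_
  refine le_trans ?_ (le_iSup (fun t => (mod3Protocol n).terminatedMass x y t m) 3)
  rw [NextMessage.terminatedMass, run_three, PMF.toOuterMeasure_map_apply,
    ← PMF.toOuterMeasure_apply_singleton, PMF.toOuterMeasure_map_apply]
  refine MeasureTheory.measure_mono fun K hK => ⟨terminated x y (by simp), ?_⟩
  exact (transcriptsOf_rounds x y K).trans hK

theorem out_finalTranscripts : (protocol n).out (finalTranscripts x y K).M23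
    (finalTranscripts x y K).M31 = PMF.pure (sumFun n x y) := by
  change PMF.pure (decode n (encode _) - decode n (encode _)) = _
  rw [decode_encode, decode_encode, add_assoc, add_sub_cancel_left, toTrits_add_toTrits]

theorem correct : (((protocol n).transcripts x y).bind fun T => (protocol n).out T.M23 T.M31) =
    PMF.pure (sumFun n x y) := by
  rw [transcripts_eq, PMF.bind_map]
  simp only [Function.comp_def, out_finalTranscripts, PMF.bind_const]

theorem isSecure (p : PMF ((Fin n → Fin 2) × (Fin n → Fin 2))) :
    (protocol n).IsSecure p (sumFunctionality n) := by
  have hlaw := Protocol.law_eq (P := protocol n) (p := p) (F := sumFun n)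
    fun x y _ => correct x y
  simp only [transcripts_eq] at hlaw
  refine ⟨fun x y _ => correct x y, ?_, ?_, ?_⟩ <;> rw [hlaw]
  · refine markovChain_of_map_eq (φ := fun T => (T.M12, T.M31)) (b := Prod.fst)
      (c := fun xy => (xy.2, sumFun n xy.1 xy.2)) (fun _ _ => rfl) (fun _ _ => rfl)
      (fun _ _ => rfl) ?_
    rintro ⟨x, y⟩ ⟨x', y'⟩ (rfl : x = x')
    rw [PMF.map_comp, PMF.map_comp]
    rfl
  · refine markovChain_of_map_eq (φ := fun T => (T.M12, T.M23)) (b := Prod.snd)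
      (c := fun xy => (xy.1, sumFun n xy.1 xy.2)) (fun _ _ => rfl) (fun _ _ => rfl)
      (fun _ _ => rfl) ?_
    have key : ∀ x y : Fin n → Fin 2, ((PMF.uniformOfFintype (Fin n → Fin 3)).map
        (finalTranscripts x y)).map (fun T => (T.M12, T.M23)) =
        (PMF.uniformOfFintype (Fin n → Fin 3)).map fun L =>
          ((encode L, []), (encode (L + toTrits y), [])) := fun x y => by
      -- Substituting `L = K + x` shows that Bob sees a uniform vector whatever `x` is.
      conv_rhs => rw [← map_uniformOfFintype_equiv (Equiv.addRight (toTrits x))]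
      rw [PMF.map_comp, PMF.map_comp]
      rfl
    rintro ⟨x, y⟩ ⟨x', y'⟩ (rfl : y = y')
    exact (key x y).trans (key x' y).symm
  · refine markovChain_of_map_eq (φ := fun T => (T.M23, T.M31))
      (b := fun xy => sumFun n xy.1 xy.2) (c := fun xy => (xy.1, xy.2)) (fun _ _ => rfl)
      (fun _ _ => rfl) (fun _ _ => rfl) ?_
    have key : ∀ x y : Fin n → Fin 2, ((PMF.uniformOfFintype (Fin n → Fin 3)).map
        (finalTranscripts x y)).map (fun T => (T.M23, T.M31)) =
        (PMF.uniformOfFintype (Fin n → Fin 3)).map fun K =>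
          ((encode (K + sumFun n x y), []), (encode K, [])) := fun x y => by
      rw [PMF.map_comp]
      simp only [Function.comp_def, finalTranscripts, add_assoc, toTrits_add_toTrits]
    rintro ⟨x, y⟩ ⟨x', y'⟩ (h : sumFun n x y = sumFun n x' y')
    exact (key x y).trans (h ▸ (key x' y').symm)

/-- Given the inputs, the outcome is a function of `K`, so every possible value of the views has
conditional probability at least 3^-n. -/
theorem randomness_le (p : PMF ((Fin n → Fin 2) × (Fin n → Fin 2))) :
    (protocol n).randomness p ≤ ENNReal.ofReal (n * Real.logb 2 3) := by
  classical
  have hlaw := Protocol.law_eq (P := protocol n) (p := p) (F := sumFun n)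
    fun x y _ => correct x y
  have h := condEntropy_le ((protocol n).law p)
    (fun o => (Protocol.viewAlice o, Protocol.viewBob o, Protocol.viewCharlie o))
    (fun o => (o.x, o.y)) (N := 3 ^ n) fun a b hab => by
      rw [← PMF.mem_support_iff, PMF.mem_support_map_iff] at hab
      obtain ⟨o, ho, hoab⟩ := hab
      have hb : b = (o.x, o.y) := (Prod.mk.inj hoab).2.symm
      rw [← hoab, hb]
      refine le_trans ?_ (mul_le_mul_left (le_map_apply ((protocol n).law p) _ o) _)
      rw [hlaw, PMF.mem_support_bind_iff] at ho
      obtain ⟨xy, _, hxy⟩ := ho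
      rw [transcripts_eq, PMF.map_comp, PMF.mem_support_map_iff] at hxy
      obtain ⟨K, _, rfl⟩ := hxy
      rw [hlaw, bind_map_apply p (fun xy => (protocol n).transcripts xy.1 xy.2)
        (fun xy T => (⟨xy.1, xy.2, T, sumFun n xy.1 xy.2⟩ : Outcome _ _ _))
        (fun o => (o.x, o.y)) (b := id) (fun _ _ => rfl), PMF.bind_apply]
      refine le_trans ?_ (mul_le_mul_left (ENNReal.le_tsum xy) _)
      have hK : (PMF.uniformOfFintype (Fin n → Fin 3) K) * ((3 ^ n : ℕ) : ℝ≥0∞) = 1 := by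
        rw [PMF.uniformOfFintype_apply]
        simp only [Fintype.card_fun, Fintype.card_fin]
        exact ENNReal.inv_mul_cancel (by positivity) (by finiteness)
      have hpb : (∑' i, if xy = i then p i else 0) = p xy := by
        rw [tsum_eq_single xy fun i hi => if_neg hi.symm, if_pos rfl]
      simp only [id, Prod.mk.eta, hpb, Function.comp_apply]
      rw [transcripts_eq, PMF.map_comp, mul_assoc]
      refine (mul_one _).ge.trans (mul_le_mul_right ?_ _)
      rw [← hK]
      exact mul_le_mul_left (le_map_apply _ _ K) _
  rwa [Nat.cast_pow, Real.logb_pow] at h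

end Mod3

end ThreeParty

end

theorem mainTheorem10 (n : ℕ) (p : PMF ((Fin n → Fin 2) × (Fin n → Fin 2)))
    (hp : ∀ xy, p xy ≠ 0) :
    (∀ P : ThreeParty.Protocol (Fin n → Fin 2) (Fin n → Fin 2) (Fin n → Fin 3),
      P.IsSecure p (ThreeParty.sumFunctionality n) →
        ENNReal.ofReal (n * Real.logb 2 3) ≤ P.H31 p ∧
        ENNReal.ofReal (n * Real.logb 2 3) ≤ P.H23 p ∧
        ENNReal.ofReal (1.5 * n) ≤ P.H12 p) ∧
    ENNReal.ofReal (n * Real.logb 2 3) ≤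
      ThreeParty.requiredRandomness p (ThreeParty.sumFunctionality n) ∧
    (∃ P : ThreeParty.Protocol (Fin n → Fin 2) (Fin n → Fin 2) (Fin n → Fin 3),
      P.toNextMessage = ThreeParty.mod3Protocol n ∧
      P.IsSecure p (ThreeParty.sumFunctionality n) ∧
      P.randomness p = ThreeParty.requiredRandomness p (ThreeParty.sumFunctionality n) ∧
      P.randomness p = ENNReal.ofReal (n * Real.logb 2 3)) := by
  have hlower : ENNReal.ofReal (n * Real.logb 2 3) ≤
      ThreeParty.requiredRandomness p (ThreeParty.sumFunctionality n) :=
    le_iInf₂ fun P hP => hP.le_randomness hp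
  have hsec := ThreeParty.Mod3.isSecure p
  have hle := ThreeParty.Mod3.randomness_le p
  have hreq : ThreeParty.requiredRandomness p (ThreeParty.sumFunctionality n) ≤
      (ThreeParty.Mod3.protocol n).randomness p := 
    iInf₂_le (ThreeParty.Mod3.protocol n) hsec
  exact ⟨fun P hP => ⟨hP.le_H31 hp, hP.le_H23 hp, hP.le_H12 hp⟩, hlower,
    ThreeParty.Mod3.protocol n, rfl, hsec, le_antisymm (hle.trans hlower) hreq,
    le_antisymm hle (hlower.trans hreq)⟩
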